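/- A Markov decision process (MDP) consists of a finite non-empty vertex set $V$, $|V|=n$, partitioned into player-1 vertices $V_1$ and random vertices $V_R$, an edge set $E\subseteq V\times V$ without self-loops in which every vertex has an outgoing edge, and for every $v\in V_R$ a probability distribution on $V$ whose support is $\{w : (v,w)\in E\}$. An end-component is a non-empty set $X\subseteq V$ such that the subgraph induced by $X$ is strongly connected (a single vertex counts as strongly connected) and every edge that leaves a random vertex of $X$ ends in $X$. A maximal end-component (MEC) is an end-component that is maximal under inclusion. The MEC decomposition consists of all MECs together with the set of the vertices that belong to no MEC. In the set-based symbolic model, an algorithm is a finite deterministic random-access program (with arithmetic on natural numbers, indirect addressing and recursive procedures) that accesses the MDP only through stored sets of vertices and of edges, initially $V,V_1,V_R,E$, by the following symbolic operations: $\cup,\cap,\setminus$ and the tests $\subseteq,=$ on two vertex sets or two edge sets; the product $X\times Y$ of two vertex sets; $\mathrm{Pre}_F(X)=\{v : \exists w\in X,\ (v,w)\in F\}$ and $\mathrm{Post}_F(X)=\{v : \exists w\in X,\ (w,v)\in F\}$ for a stored edge set $F$ and a stored vertex set $X$; picking an arbitrary vertex of a non-empty vertex set (stored as a singleton set); the cardinality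 of a vertex set; and output of a vertex set. Each of them costs one symbolic operation; computations with numbers are free. The symbolic space is the number of registers that the run uses for storing sets; it bounds the number of sets stored at any one time. A program computes the MEC decomposition within given bounds if, on every MDP and however the picked vertices are selected, it halts within these bounds, having put out every MEC exactly once and finally the set of the vertices in no MEC. **Theorem.** (1) There is a program that receives, besides the MDP, one natural number as a parameter, such that for every real $0<\epsilon\le 1/2$ there is a constant $C$ for which the program, given any MDP with $n$ vertices and the parameter $\lceil n^{\epsilon}\rceil$, computes the MEC decomposition with at most $C\,n^{2-\epsilon}\log n$ symbolic operations and symbolic space at most $C\,n^{\epsilon}\log n$. (2) For every rational $0<\epsilon\le 1/2$ there are a program without parameter and a constant $C$ such that the program computes the MEC decomposition of every MDP with $n$ vertices with at most $C\,n^{2-\epsilon}\log n$ symbolic operations and symbolic space at most $C\,n^{\epsilon}\log n$. (3) In particular, some program without parameter computes the MEC decomposition of every MDP with $n$ vertices in $O(n^{3/2}\log n)$ symbolic operations and $O(\sqrt n\,\log n)$ symbolic space. -/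

import Mathlib

/-! ## Markov decision processes and maximal end-components -/

/-- A Markov decision process on the finite vertex set `V`: the vertices in `random` are the random
vertices, all the others are player-1 vertices. There are no self-loops, and every vertex has an
outgoing edge. -/
structure MDP (V : Type*) [Fintype V] [DecidableEq V] where
  edges : Finset (V × V)
  random : Finset V
  /-- the probabilistic transition function, on the random vertices -/
  trans : {v : V // v ∈ random} → PMF V
  mem_edges_iff : ∀ (v : {v : V // v ∈ random}) (w : V), (v.1, w) ∈ edges ↔ 0 < trans v w
  no_loop : ∀ v : V, (v, v) ∉ edges
  exists_succ : ∀ v : V, ∃ w : V, (v, w) ∈ edges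

namespace MDP

variable {V : Type*} [Fintype V] [DecidableEq V]

/-- The player-1 vertices. -/
def player1 (P : MDP V) : Finset V := P.randomᶜ

/-- The subgraph induced by `X` is strongly connected. -/
def StronglyConnected (P : MDP V) (X : Finset V) : Prop :=
  ∀ u ∈ X, ∀ v ∈ X,
    Relation.ReflTransGen (fun a b => a ∈ X ∧ b ∈ X ∧ (a, b) ∈ P.edges) u v

/-- End-components; a single player-1 vertex is a (trivial) end-component. -/
def IsEC (P : MDP V) (X : Finset V) : Prop :=
  X.Nonempty ∧ P.StronglyConnected X ∧
    ∀ v ∈ X, v ∈ P.random → ∀ w, (v, w) ∈ P.edges → w ∈ X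

/-- Maximal end-components: end-components that are maximal under inclusion. -/
def IsMEC (P : MDP V) (X : Finset V) : Prop := Maximal P.IsEC X

/-- The list `l` presents the MEC decomposition: it lists every MEC exactly once, and ends with the
(possibly empty) set of the vertices that belong to no MEC. -/
def IsMECDecomposition (P : MDP V) (l : List (Finset V)) : Prop :=
  ∃ (mecs : List (Finset V)) (rest : Finset V), l = mecs ++ [rest] ∧
    mecs.Nodup ∧ (∀ X, X ∈ mecs ↔ P.IsMEC X) ∧
    ∀ v, v ∈ rest ↔ ∀ X, P.IsMEC X → v ∉ X

end MDP

/-! ## The set-based symbolic model of computation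

A symbolic algorithm is a finite program for a random access machine with three memories, each
indexed by the natural numbers and addressed indirectly: natural numbers, sets of vertices, sets of
edges. Programs know nothing about `V`: they reach the MDP only by the symbolic instructions, and
a picked vertex is only available as a singleton set. -/

namespace Symbolic

/-- Expressions over the numeric memory; they serve as values, conditions and addresses. -/
inductive NExp : Type
  | const (k : ℕ)
  | reg (a : NExp)
  | add (e f : NExp)
  | sub (e f : NExp)
  | mul (e f : NExp)
  | div (e f : NExp)

/-- `reg a` is the content of the numeric register whose address is the value of `a`; subtraction
is truncated and division is rounded down. -/
def NExp.eval (m : ℕ → ℕ) : NExp → ℕ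
  | .const k => k
  | .reg a => m (a.eval m)
  | .add e f => e.eval m + f.eval m
  | .sub e f => e.eval m - f.eval m
  | .mul e f => e.eval m * f.eval m
  | .div e f => e.eval m / f.eval m

inductive SetOp : Type
  | union
  | inter
  | diff

def SetOp.eval {α : Type*} [DecidableEq α] : SetOp → Finset α → Finset α → Finset α
  | .union, X, Y => X ∪ Y
  | .inter, X, Y => X ∩ Y
  | .diff, X, Y => X \ Y

inductive SetTest : Type
  | subset
  | eq

/-- The outcome of a test is `1` for true and `0` for false. -/
def SetTest.eval {α : Type*} [DecidableEq α] : SetTest → Finset α → Finset α → ℕ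
  | .subset, X, Y => if X ⊆ Y then 1 else 0
  | .eq, X, Y => if X = Y then 1 else 0

/-- Symbolic instructions. All arguments are addresses; `d` is the address of the result. -/
inductive Instr : Type
  | vertOp (o : SetOp) (d a b : NExp)
  | edgeOp (o : SetOp) (d a b : NExp)
  | vertTest (t : SetTest) (d a b : NExp)
  | edgeTest (t : SetTest) (d a b : NExp)
  | prod (d a b : NExp)
  | pre (d e a : NExp)
  | post (d e a : NExp)
  | pick (d a : NExp)
  | card (d a : NExp)
  | emit (a : NExp)

/-- Statements. Conditions hold when their value is nonzero; `call p` runs the procedure number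
`p`. -/
inductive Stmt : Type
  | skip
  | assign (d e : NExp)
  | sym (i : Instr)
  | seq (s t : Stmt)
  | ite (c : NExp) (s t : Stmt)
  | loop (c : NExp) (s : Stmt)
  | call (p : ℕ)

/-- A program: a main statement and finitely many procedures, which may be recursive. -/
structure Program : Type where
  main : Stmt
  procs : List Stmt

section Semantics

variable {V : Type*} [Fintype V] [DecidableEq V]

/-- The vertices with an edge of `E` into `S`. -/
def pre (E : Finset (V × V)) (S : Finset V) : Finset V :=
  Finset.univ.filter fun v => ∃ w ∈ S, (v, w) ∈ E

/-- The vertices with an edge of `E` from `S`. -/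
def post (E : Finset (V × V)) (S : Finset V) : Finset V :=
  Finset.univ.filter fun v => ∃ w ∈ S, (w, v) ∈ E

/-- Machine states: the three memories, the sets put out so far, the number of symbolic operations
so far, and the numbers of registers reserved so far for sets of vertices and for sets of edges. -/
structure State (V : Type*) where
  num : ℕ → ℕ
  vert : ℕ → Finset V
  edge : ℕ → Finset (V × V)
  out : List (Finset V)
  ops : ℕ
  vertRegs : ℕ
  edgeRegs : ℕ

/-- Symbolic space: the registers `0, 1, …` up to the largest address at which a set was ever
stored all count, so this is at least the number of sets stored at any one time. -/
def State.space (σ : State V) : ℕ := σ.vertRegs + σ.edgeRegs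

def State.setNum (σ : State V) (d k : ℕ) : State V :=
  { σ with num := Function.update σ.num d k }

def State.setVert (σ : State V) (d : ℕ) (X : Finset V) : State V :=
  { σ with vert := Function.update σ.vert d X, vertRegs := max σ.vertRegs (d + 1) }

def State.setEdge (σ : State V) (d : ℕ) (F : Finset (V × V)) : State V :=
  { σ with edge := Function.update σ.edge d F, edgeRegs := max σ.edgeRegs (d + 1) }

/-- The effect of a symbolic instruction on the memories and the output. Which vertex of `S` is
returned by a pick after `t` symbolic operations is decided by `choice t S`. -/
def Instr.effect (choice : ℕ → Finset V → V) (σ : State V) : Instr → State V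
  | .vertOp o d a b =>
      σ.setVert (d.eval σ.num) (o.eval (σ.vert (a.eval σ.num)) (σ.vert (b.eval σ.num)))
  | .edgeOp o d a b =>
      σ.setEdge (d.eval σ.num) (o.eval (σ.edge (a.eval σ.num)) (σ.edge (b.eval σ.num)))
  | .vertTest t d a b =>
      σ.setNum (d.eval σ.num) (t.eval (σ.vert (a.eval σ.num)) (σ.vert (b.eval σ.num)))
  | .edgeTest t d a b =>
      σ.setNum (d.eval σ.num) (t.eval (σ.edge (a.eval σ.num)) (σ.edge (b.eval σ.num)))
  | .prod d a b =>
      σ.setEdge (d.eval σ.num) (σ.vert (a.eval σ.num) ×ˢ σ.vert (b.eval σ.num))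
  | .pre d e a =>
      σ.setVert (d.eval σ.num) (Symbolic.pre (σ.edge (e.eval σ.num)) (σ.vert (a.eval σ.num)))
  | .post d e a =>
      σ.setVert (d.eval σ.num) (Symbolic.post (σ.edge (e.eval σ.num)) (σ.vert (a.eval σ.num)))
  | .pick d a =>
      σ.setVert (d.eval σ.num)
        (if (σ.vert (a.eval σ.num)).Nonempty then {choice σ.ops (σ.vert (a.eval σ.num))} else ∅)
  | .card d a => σ.setNum (d.eval σ.num) (σ.vert (a.eval σ.num)).card
  | .emit a => { σ with out := σ.out ++ [σ.vert (a.eval σ.num)] }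

/-- Every symbolic instruction counts as one symbolic operation. -/
def Instr.step (choice : ℕ → Finset V → V) (i : Instr) (σ : State V) : State V :=
  { i.effect choice σ with ops := σ.ops + 1 }

/-- `Exec choice procs s σ τ`: started in state `σ`, the statement `s` terminates in state `τ`. -/
inductive Exec (choice : ℕ → Finset V → V) (procs : List Stmt) :
    Stmt → State V → State V → Prop
  | skip (σ : State V) : Exec choice procs .skip σ σ
  | assign (d e : NExp) (σ : State V) :
      Exec choice procs (.assign d e) σ (σ.setNum (d.eval σ.num) (e.eval σ.num))
  | sym (i : Instr) (σ : State V) : Exec choice procs (.sym i) σ (i.step choice σ)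
  | seq {s t : Stmt} {σ τ υ : State V} :
      Exec choice procs s σ τ → Exec choice procs t τ υ → Exec choice procs (.seq s t) σ υ
  | ite_true {c : NExp} {s t : Stmt} {σ τ : State V} :
      c.eval σ.num ≠ 0 → Exec choice procs s σ τ → Exec choice procs (.ite c s t) σ τ
  | ite_false {c : NExp} {s t : Stmt} {σ τ : State V} :
      c.eval σ.num = 0 → Exec choice procs t σ τ → Exec choice procs (.ite c s t) σ τ
  | loop_true {c : NExp} {s : Stmt} {σ τ υ : State V} :
      c.eval σ.num ≠ 0 → Exec choice procs s σ τ → Exec choice procs (.loop c s) τ υ →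
      Exec choice procs (.loop c s) σ υ
  | loop_false {c : NExp} {s : Stmt} {σ : State V} :
      c.eval σ.num = 0 → Exec choice procs (.loop c s) σ σ
  | call {p : ℕ} {s : Stmt} {σ τ : State V} :
      procs[p]? = some s → Exec choice procs s σ τ → Exec choice procs (.call p) σ τ

/-- The final state is determined by the initial one. -/
theorem Exec.deterministic {choice : ℕ → Finset V → V} {procs : List Stmt} {s : Stmt}
    {σ τ τ' : State V} (h : Exec choice procs s σ τ) (h' : Exec choice procs s σ τ') :
    τ = τ' := by
  induction h generalizing τ' with
  | skip | assign | sym => cases h'; rfl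
  | seq _ _ ih₁ ih₂ =>
    cases h' with
    | seq h₁ h₂ => cases ih₁ h₁; exact ih₂ h₂
  | ite_true hc _ ih =>
    cases h' with
    | ite_true _ h => exact ih h
    | ite_false hc' _ => exact absurd hc' hc
  | ite_false hc _ ih =>
    cases h' with
    | ite_true hc' _ => exact absurd hc hc'
    | ite_false _ h => exact ih h
  | loop_true hc _ _ ih₁ ih₂ =>
    cases h' with
    | loop_true _ h₁ h₂ => cases ih₁ h₁; exact ih₂ h₂
    | loop_false hc' => exact absurd hc' hc
  | loop_false hc =>
    cases h' with
    | loop_true hc' _ _ => exact absurd hc hc'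
    | loop_false _ => rfl
  | call hp _ ih =>
    cases h' with
    | call hp' h => cases hp.symm.trans hp'; exact ih h

/-- The initial state: the vertex registers `0, 1, 2` hold the set of all vertices, of the player-1
vertices and of the random vertices, the edge register `0` holds the edge set, and the numeric
register `0` holds the parameter `k`. -/
def init (P : MDP V) (k : ℕ) : State V where
  num := fun i => if i = 0 then k else 0
  vert := fun i =>
    if i = 0 then Finset.univ else if i = 1 then P.player1 else if i = 2 then P.random else ∅
  edge := fun i => if i = 0 then P.edges else ∅
  out := []
  ops := 0
  vertRegs := 3
  edgeRegs := 1

/-- On the MDP `P` with numeric parameter `k`, and however the picked vertices are selected, the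
program halts having put out the MEC decomposition of `P`, after at most `T` symbolic operations and
with symbolic space at most `S`. -/
def Program.ComputesMECs (prog : Program) (P : MDP V) (k : ℕ) (T S : ℝ) : Prop :=
  ∀ choice : ℕ → Finset V → V, (∀ t X, X.Nonempty → choice t X ∈ X) →
    ∃ σ : State V, Exec choice prog.procs prog.main (init P k) σ ∧
      P.IsMECDecomposition σ.out ∧ (σ.ops : ℝ) ≤ T ∧ (σ.space : ℝ) ≤ S

end Semantics

end Symbolic

/-!
As long as there are undecided vertices, the subgraph that they induce has a bottom strongly
connected component. This is a maximal end-component; it is put out, and it is decided together with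
its random attractor. A bottom component is found in two ways.

Computations with numbers are free. Hence the vertices are numbered, and for each of the `O(log n)`
binary digits the set of the vertices whose number has this digit is stored. So `O(log n)`
operations identify a picked vertex or fetch a vertex by its number, and what is known about the
graph is kept in arrays of numbers. With `h ≈ √n`, the undecided successors of every undecided
vertex that has at most `2 * h` of them are learned, and this is repeated whenever `h` further
vertices have been decided. A search among the known vertices is free. Where it fails, every bottom
component contains an unknown vertex together with its more than `h` undecided successors, so a
symbolic search with `O(n)` operations costs `O(n / h)` operations for each vertex of the
component it finds.
-/

/-! ## Maximal end-components as bottom components -/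

namespace MDP

variable {V : Type*} [Fintype V] [DecidableEq V]

theorem one_lt_card (P : MDP V) [Nonempty V] : 1 < Fintype.card V := by
  obtain ⟨v⟩ := ‹Nonempty V›
  obtain ⟨w, hw⟩ := P.exists_succ v
  exact Fintype.one_lt_card_iff.2 ⟨v, w, fun h => P.no_loop v (by rwa [← h] at hw)⟩

theorem IsEC.exists_isMEC {P : MDP V} {X : Finset V} (h : P.IsEC X) :
    ∃ Y, P.IsMEC Y ∧ X ⊆ Y := by
  obtain ⟨Y, hXY, hY⟩ := (Set.toFinite {Y | P.IsEC Y}).exists_le_maximal h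
  exact ⟨Y, hY, hXY⟩

/-- Reachability in the subgraph induced by `A`. -/
def Reach (P : MDP V) (A : Finset V) : V → V → Prop :=
  Relation.ReflTransGen fun a b => a ∈ A ∧ b ∈ A ∧ (a, b) ∈ P.edges

/-- `r` lies in a bottom strongly connected component of the subgraph induced by `A`. -/
def IsRoot (P : MDP V) (A : Finset V) (r : V) : Prop :=
  r ∈ A ∧ ∀ w, P.Reach A r w → P.Reach A w r

/-- No edge of the subgraph induced by `A` leaves `T`. -/
def IsTrap (P : MDP V) (A T : Finset V) : Prop :=
  ∀ a ∈ T, ∀ b ∈ A, (a, b) ∈ P.edges → b ∈ T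

open Classical in
/-- The set of the vertices that `r` reaches in the subgraph induced by `A`; if `r` is a root, this
is its bottom component. -/
noncomputable def reachSet (P : MDP V) (A : Finset V) (r : V) : Finset V :=
  Finset.univ.filter (P.Reach A r)

section Reach

variable {P : MDP V} {A B T T' : Finset V} {r u v w : V}

@[simp] theorem mem_reachSet : w ∈ P.reachSet A r ↔ P.Reach A r w := by
  classical simp [reachSet]

theorem self_mem_reachSet : r ∈ P.reachSet A r :=
  mem_reachSet.2 .refl

theorem Reach.mem (h : P.Reach A u v) (hu : u ∈ A) : v ∈ A := by
  cases h with
  | refl => exact hu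
  | tail _ h => exact h.2.1

theorem Reach.mono (hAB : A ⊆ B) (h : P.Reach A u v) : P.Reach B u v :=
  Relation.ReflTransGen.mono (fun _ _ h => ⟨hAB h.1, hAB h.2.1, h.2.2⟩) _ _ h

theorem reachSet_subset (hr : r ∈ A) : P.reachSet A r ⊆ A :=
  fun _ hw => (mem_reachSet.1 hw).mem hr

theorem IsTrap.self : P.IsTrap A A := fun _ _ _ hb _ => hb

theorem IsTrap.mem_of_reach (h : P.IsTrap A T) (hu : u ∈ T) (huv : P.Reach A u v) : v ∈ T := by
  induction huv with
  | refl => exact hu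
  | tail _ hbc ih => exact h _ ih _ hbc.2.1 hbc.2.2

theorem isTrap_reachSet (hr : r ∈ A) : P.IsTrap A (P.reachSet A r) := fun _ ha _ hb hab =>
  mem_reachSet.2 ((mem_reachSet.1 ha).tail ⟨reachSet_subset hr ha, hb, hab⟩)

/-- A search backward from `r` strips a trap `T` of vertices that reach `r`; once nothing is left,
`r` is a root. -/
theorem IsTrap.isRoot (h : P.IsTrap A T) (hr : r ∈ A) (hrT : r ∈ T)
    (hT : ∀ v ∈ T, P.Reach A v r) : P.IsRoot A r :=
  ⟨hr, fun _ hw => hT _ (h.mem_of_reach hrT hw)⟩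

theorem reach_reachSet (hr : r ∈ A) (hu : u ∈ P.reachSet A r) (huv : P.Reach A u v) :
    P.Reach (P.reachSet A r) u v := by
  induction huv with
  | refl => exact .refl
  | @tail b c hb hbc ih =>
    have hbC : b ∈ P.reachSet A r := (isTrap_reachSet hr).mem_of_reach hu hb
    exact ih.tail ⟨hbC, isTrap_reachSet hr b hbC c hbc.2.1 hbc.2.2, hbc.2.2⟩

theorem IsRoot.stronglyConnected_reachSet (hr : P.IsRoot A r) :
    P.StronglyConnected (P.reachSet A r) := fun u hu _ hv =>
  reach_reachSet hr.1 hu ((hr.2 u (mem_reachSet.1 hu)).trans (mem_reachSet.1 hv))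

theorem IsEC.subset_reachSet {X : Finset V} (hX : P.IsEC X) (hXA : X ⊆ A) {u : V} (huX : u ∈ X)
    (hu : P.Reach A r u) : X ⊆ P.reachSet A r := fun v hv =>
  mem_reachSet.2 (hu.trans (Reach.mono hXA (hX.2.1 u huX v hv)))

end Reach

/-- A stage of the computation of the MEC decomposition: the MECs in `out` have been found, `R`
holds the decided vertices in no MEC, and the vertices in `A` are undecided. The random attractor
of the decided vertices is being removed from `A`: the vertices in `F` are the latest ones to be
decided, and only into these may undecided random vertices have edges that leave `A`. -/
structure PartialDecomposition (P : MDP V) (A F R : Finset V) (out : List (Finset V)) : Prop where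
  mem_or_mem : ∀ v ∈ A, v ∈ P.random → ∀ w, (v, w) ∈ P.edges → w ∈ A ∨ w ∈ F
  disjoint_frontier : Disjoint F A
  nodup : out.Nodup
  isMEC : ∀ X ∈ out, P.IsMEC X
  disjoint : ∀ X ∈ out, Disjoint X A
  mem_or_subset : ∀ X, P.IsMEC X → X ∈ out ∨ X ⊆ A
  mem_rest : ∀ v, v ∈ R ↔ v ∉ A ∧ ∀ X ∈ out, v ∉ X

namespace PartialDecomposition

variable {P : MDP V} {A F R : Finset V} {out : List (Finset V)} {r : V}

theorem univ (P : MDP V) : P.PartialDecomposition Finset.univ ∅ ∅ [] := by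
  constructor <;> simp

theorem isMECDecomposition (h : P.PartialDecomposition ∅ F R out) :
    P.IsMECDecomposition (out ++ [R]) := by
  have hmem : ∀ X, X ∈ out ↔ P.IsMEC X := fun X => ⟨h.isMEC X, fun hX =>
    (h.mem_or_subset X hX).resolve_right fun h0 =>
      hX.1.1.ne_empty (Finset.subset_empty.1 h0)⟩
  exact ⟨out, R, rfl, h.nodup, hmem, fun v => by simp [h.mem_rest, hmem]⟩

theorem isMEC_reachSet (h : P.PartialDecomposition A ∅ R out) (hr : P.IsRoot A r) :
    P.IsMEC (P.reachSet A r) := by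
  have hEC : P.IsEC (P.reachSet A r) := by
    refine ⟨⟨r, self_mem_reachSet⟩, hr.stronglyConnected_reachSet, fun v hv hvr w hw => ?_⟩
    have hwA := h.mem_or_mem v (reachSet_subset hr.1 hv) hvr w hw
    exact isTrap_reachSet hr.1 v hv w (hwA.resolve_right (by simp)) hw
  refine ⟨hEC, fun X hX hCX => ?_⟩
  have hrX : r ∈ X := hCX self_mem_reachSet
  obtain ⟨Y, hY, hXY⟩ := hX.exists_isMEC
  have hYA : Y ⊆ A := (h.mem_or_subset Y hY).resolve_left fun hY' =>
    Finset.disjoint_left.1 (h.disjoint Y hY') (hXY hrX) hr.1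
  exact hX.subset_reachSet (hXY.trans hYA) hrX .refl

theorem removeComponent (h : P.PartialDecomposition A ∅ R out) (hr : P.IsRoot A r) :
    P.PartialDecomposition (A \ P.reachSet A r) (P.reachSet A r) R
      (out ++ [P.reachSet A r]) where
  mem_or_mem v hv hvr w hw := by
    have := h.mem_or_mem v (Finset.mem_sdiff.1 hv).1 hvr w hw
    simp only [Finset.notMem_empty, or_false] at this
    simp only [Finset.mem_sdiff, this, true_and, em']
  disjoint_frontier := Finset.disjoint_sdiff
  nodup := by
    refine h.nodup.append (List.nodup_singleton _) (List.disjoint_singleton.2 fun hC => ?_)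
    exact Finset.disjoint_left.1 (h.disjoint _ hC) self_mem_reachSet hr.1
  isMEC X hX := by
    rcases List.mem_append.1 hX with hX | hX
    · exact h.isMEC X hX
    · exact List.mem_singleton.1 hX ▸ h.isMEC_reachSet hr
  disjoint X hX := by
    rcases List.mem_append.1 hX with hX | hX
    · exact (h.disjoint X hX).mono_right Finset.sdiff_subset
    · exact List.mem_singleton.1 hX ▸ Finset.disjoint_sdiff
  mem_or_subset X hX := by
    rcases h.mem_or_subset X hX with hX' | hXA
    · exact .inl (List.mem_append_left _ hX')
    by_cases hd : Disjoint X (P.reachSet A r)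
    · exact .inr fun x hx => Finset.mem_sdiff.2 ⟨hXA hx, Finset.disjoint_left.1 hd hx⟩
    obtain ⟨u, huX, hu⟩ := Finset.not_disjoint_iff.1 hd
    have hXC := hX.1.subset_reachSet hXA huX (mem_reachSet.1 hu)
    have hCX := hX.2 (h.isMEC_reachSet hr).1 hXC
    exact .inl (by simp [hXC.antisymm hCX])
  mem_rest v := by
    have hCA : v ∈ P.reachSet A r → v ∈ A := fun hv => reachSet_subset hr.1 hv
    simp only [h.mem_rest, Finset.mem_sdiff, List.mem_append, List.mem_singleton, or_imp,
      forall_and, forall_eq]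
    tauto

/-- One step of the removal of the random attractor: a random vertex with an edge into `F` belongs
to no undecided MEC. -/
theorem removeAttracted (h : P.PartialDecomposition A F R out) :
    P.PartialDecomposition (A \ (Symbolic.pre P.edges F ∩ P.random ∩ A))
      (Symbolic.pre P.edges F ∩ P.random ∩ A)
      (R ∪ (Symbolic.pre P.edges F ∩ P.random ∩ A)) out where
  mem_or_mem v hv hvr w hw := by
    have hvA := (Finset.mem_sdiff.1 hv).1
    have hwA : w ∈ A := (h.mem_or_mem v hvA hvr w hw).resolve_right fun hwF =>
      (Finset.mem_sdiff.1 hv).2 (by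
        simp only [Symbolic.pre, Finset.mem_inter, Finset.mem_filter, Finset.mem_univ, true_and]
        exact ⟨⟨⟨w, hwF, hw⟩, hvr⟩, hvA⟩)
    simp only [Finset.mem_sdiff, hwA, true_and, em']
  disjoint_frontier := Finset.disjoint_sdiff
  nodup := h.nodup
  isMEC := h.isMEC
  disjoint X hX := (h.disjoint X hX).mono_right Finset.sdiff_subset
  mem_or_subset X hX := by
    refine (h.mem_or_subset X hX).imp_right fun hXA x hx => Finset.mem_sdiff.2 ⟨hXA hx, ?_⟩
    simp only [Symbolic.pre, Finset.mem_inter, Finset.mem_filter, Finset.mem_univ, true_and]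
    rintro ⟨⟨⟨w, hwF, hw⟩, hxr⟩, -⟩
    exact Finset.disjoint_left.1 h.disjoint_frontier hwF (hXA (hX.1.2.2 x hx hxr w hw))
  mem_rest v := by
    have hd : ∀ X ∈ out, v ∈ A → v ∉ X := fun X hX hvA hvX =>
      Finset.disjoint_left.1 (h.disjoint X hX) hvX hvA
    have hAtt : v ∈ Symbolic.pre P.edges F ∩ P.random ∩ A → v ∈ A := fun hv =>
      (Finset.mem_inter.1 hv).2
    simp only [Finset.mem_union, h.mem_rest, Finset.mem_sdiff]
    by_cases hv : v ∈ Symbolic.pre P.edges F ∩ P.random ∩ A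
    · simp only [hv, or_true, not_true_eq_false, and_false, not_false_eq_true, true_and, true_iff]
      exact fun X hX => hd X hX (hAtt hv)
    · simp only [hv, or_false, not_false_eq_true, and_true]

end PartialDecomposition

end MDP

/-! ## Reasoning about programs -/

namespace Symbolic

open NExp (reg)

/-- A symbolic operation is performed. -/
def State.tick {V : Type*} (σ : State V) : State V := { σ with ops := σ.ops + 1 }

attribute [simps] State.setNum State.setVert State.tick

attribute [simp] Instr.effect SetOp.eval SetTest.eval

instance : Coe ℕ NExp := ⟨.const⟩
instance (k : ℕ) : OfNat NExp k := ⟨.const k⟩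
instance : Add NExp := ⟨.add⟩
instance : Sub NExp := ⟨.sub⟩
instance : Mul NExp := ⟨.mul⟩
instance : Div NExp := ⟨.div⟩

section Eval

variable (m : ℕ → ℕ) (k : ℕ) (e f : NExp)

@[simp] theorem eval_const : NExp.eval m k = k := rfl
@[simp] theorem eval_ofNat : NExp.eval m (no_index (OfNat.ofNat k)) = OfNat.ofNat k := rfl
@[simp] theorem eval_reg : (reg e).eval m = m (e.eval m) := rfl
@[simp] theorem eval_add : (e + f).eval m = e.eval m + f.eval m := rfl
@[simp] theorem eval_sub : (e - f).eval m = e.eval m - f.eval m := rfl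
@[simp] theorem eval_mul : (e * f).eval m = e.eval m * f.eval m := rfl
@[simp] theorem eval_div : (e / f).eval m = e.eval m / f.eval m := rfl

end Eval

def block : List Stmt → Stmt
  | [] => .skip
  | s :: l => .seq s (block l)

section Frame

/-- The numeric results of the instruction are stored at addresses in `N` and its vertex sets at
addresses in `W`; it neither stores an edge set nor puts out anything. -/
def Instr.WritesTo (N W : Set ℕ) : Instr → Prop
  | .vertOp _ d _ _ | .pre d _ _ | .post d _ _ | .pick d _ => ∀ m, d.eval m ∈ W
  | .vertTest _ d _ _ | .edgeTest _ d _ _ | .card d _ => ∀ m, d.eval m ∈ N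
  | .edgeOp _ _ _ _ | .prod _ _ _ | .emit _ => False

/-- A syntactic condition under which the statement changes at most the numbers at addresses in `N`
and the vertex sets at addresses in `W`. -/
def Stmt.WritesTo (N W : Set ℕ) : Stmt → Prop
  | .skip => True
  | .assign d _ => ∀ m, d.eval m ∈ N
  | .sym i => i.WritesTo N W
  | .seq s t | .ite _ s t => s.WritesTo N W ∧ t.WritesTo N W
  | .loop _ s => s.WritesTo N W
  | .call _ => False

theorem Instr.WritesTo.mono {N W N' W' : Set ℕ} {i : Instr} (h : i.WritesTo N W) (hN : N ⊆ N')
    (hW : W ⊆ W') : i.WritesTo N' W' := by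
  cases i with
  | vertOp | pre | post | pick => exact fun m => hW (h m)
  | vertTest | edgeTest | card => exact fun m => hN (h m)
  | edgeOp | prod | emit => exact h

theorem Stmt.WritesTo.mono {N W N' W' : Set ℕ} {s : Stmt} (h : s.WritesTo N W) (hN : N ⊆ N')
    (hW : W ⊆ W') : s.WritesTo N' W' := by
  induction s with
  | skip => trivial
  | assign => exact fun m => hN (h m)
  | sym => exact Instr.WritesTo.mono h hN hW
  | seq _ _ ih₁ ih₂ | ite _ _ _ ih₁ ih₂ => exact ⟨ih₁ h.1, ih₂ h.2⟩
  | loop _ _ ih => exact ih h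
  | call => exact h

/-- From `σ` to `τ`, at most the numbers at addresses in `N` and the vertex sets at addresses in `W`
have changed. -/
structure Frame {V : Type*} (N W : Set ℕ) (σ τ : State V) : Prop where
  num : ∀ a ∉ N, τ.num a = σ.num a
  vert : ∀ a ∉ W, τ.vert a = σ.vert a
  edge : τ.edge = σ.edge
  out : τ.out = σ.out
  vertRegs_le : ∀ B, (∀ a ∈ W, a < B) → σ.vertRegs ≤ B → τ.vertRegs ≤ B
  edgeRegs : τ.edgeRegs = σ.edgeRegs

namespace Frame

variable {V : Type*} {N W N' W' : Set ℕ} {σ τ υ : State V}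

theorem refl (N W : Set ℕ) (σ : State V) : Frame N W σ σ := by
  constructor <;> simp

theorem trans (h : Frame N W σ τ) (h' : Frame N W τ υ) : Frame N W σ υ where
  num a ha := (h'.num a ha).trans (h.num a ha)
  vert a ha := (h'.vert a ha).trans (h.vert a ha)
  edge := h'.edge.trans h.edge
  out := h'.out.trans h.out
  vertRegs_le B hB hσ := h'.vertRegs_le B hB (h.vertRegs_le B hB hσ)
  edgeRegs := h'.edgeRegs.trans h.edgeRegs

theorem mono (h : Frame N W σ τ) (hN : N ⊆ N') (hW : W ⊆ W') : Frame N' W' σ τ where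
  num a ha := h.num a fun h0 => ha (hN h0)
  vert a ha := h.vert a fun h0 => ha (hW h0)
  edge := h.edge
  out := h.out
  vertRegs_le B hB := h.vertRegs_le B fun a ha => hB a (hW ha)
  edgeRegs := h.edgeRegs

theorem setNum (h : Frame N W σ τ) {d k : ℕ} (hd : d ∈ N := by simp) :
    Frame N W σ (τ.setNum d k) :=
  h.trans ⟨fun _ ha => Function.update_of_ne (ne_of_mem_of_not_mem hd ha).symm _ _,
    fun _ _ => rfl, rfl, rfl, fun _ _ => id, rfl⟩

theorem setVert (h : Frame N W σ τ) {d : ℕ} {X : Finset V} (hd : d ∈ W := by simp) :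
    Frame N W σ (τ.setVert d X) :=
  h.trans ⟨fun _ _ => rfl, fun _ ha => Function.update_of_ne (ne_of_mem_of_not_mem hd ha).symm _ _,
    rfl, rfl, fun _ hB hτ => max_le hτ (hB d hd), rfl⟩

theorem tick (h : Frame N W σ τ) : Frame N W σ τ.tick :=
  h.trans ⟨fun _ _ => rfl, fun _ _ => rfl, rfl, rfl, fun _ _ => id, rfl⟩

end Frame

end Frame

section Runs

variable {V : Type*} [Fintype V] [DecidableEq V] {choice : ℕ → Finset V → V}

theorem Instr.step_eq_tick (i : Instr) (σ : State V) :
    i.step choice σ = (i.effect choice σ).tick := by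
  cases i <;> rfl

theorem Instr.WritesTo.frame {N W : Set ℕ} {i : Instr} (h : i.WritesTo N W) (σ : State V) :
    Frame N W σ (i.step choice σ) := by
  rw [i.step_eq_tick]
  cases i with
  | vertOp | pre | post | pick => exact ((Frame.refl N W σ).setVert (h _)).tick
  | vertTest | edgeTest | card => exact ((Frame.refl N W σ).setNum (h _)).tick
  | edgeOp | prod | emit => exact h.elim

theorem Exec.frame {procs : List Stmt} {N W : Set ℕ} {s : Stmt} {σ τ : State V}
    (h : Exec choice procs s σ τ) (hs : s.WritesTo N W) : Frame N W σ τ := by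
  induction h with
  | skip | loop_false => exact .refl N W _
  | assign => exact (Frame.refl N W _).setNum (hs _)
  | sym i σ => exact Instr.WritesTo.frame hs σ
  | seq _ _ ih₁ ih₂ => exact (ih₁ hs.1).trans (ih₂ hs.2)
  | ite_true _ _ ih => exact ih hs.1
  | ite_false _ _ ih => exact ih hs.2
  | loop_true _ _ _ ih₁ ih₂ => exact (ih₁ hs).trans (ih₂ hs)
  | call => exact hs.elim

/-- Started in `σ`, the statement `s` terminates in a state that satisfies `Q`. -/
def Runs (choice : ℕ → Finset V → V) (s : Stmt) (σ : State V) (Q : State V → Prop) : Prop :=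
  ∃ τ, Exec choice [] s σ τ ∧ Q τ

variable {c d e : NExp} {i : Instr} {s t : Stmt} {σ : State V} {Q Q' : State V → Prop}

theorem Runs.mono (h : Runs choice s σ Q) (hQ : ∀ τ, Q τ → Q' τ) : Runs choice s σ Q' :=
  let ⟨τ, hτ, hQτ⟩ := h
  ⟨τ, hτ, hQ τ hQτ⟩

theorem Runs.mono_frame {N W : Set ℕ} (h : Runs choice s σ Q) (hs : s.WritesTo N W)
    (hQ : ∀ τ, Frame N W σ τ → Q τ → Q' τ) : Runs choice s σ Q' :=
  let ⟨τ, hτ, hQτ⟩ := h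
  ⟨τ, hτ, hQ τ (hτ.frame hs) hQτ⟩

theorem runs_skip : Runs choice .skip σ Q ↔ Q σ :=
  ⟨fun ⟨_, h, hQ⟩ => by cases h; exact hQ, fun h => ⟨σ, .skip σ, h⟩⟩

@[simp] theorem runs_assign :
    Runs choice (.assign d e) σ Q ↔ Q (σ.setNum (d.eval σ.num) (e.eval σ.num)) :=
  ⟨fun ⟨_, h, hQ⟩ => by cases h; exact hQ, fun h => ⟨_, .assign d e σ, h⟩⟩

@[simp] theorem runs_sym : Runs choice (.sym i) σ Q ↔ Q (i.effect choice σ).tick := by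
  rw [← i.step_eq_tick]
  exact ⟨fun ⟨_, h, hQ⟩ => by cases h; exact hQ, fun h => ⟨_, .sym i σ, h⟩⟩

theorem runs_seq :
    Runs choice (.seq s t) σ Q ↔ Runs choice s σ fun τ => Runs choice t τ Q :=
  ⟨fun ⟨_, h, hQ⟩ => by cases h with | seq hs ht => exact ⟨_, hs, _, ht, hQ⟩,
    fun ⟨_, hs, _, ht, hQ⟩ => ⟨_, .seq hs ht, hQ⟩⟩

theorem runs_ite :
    Runs choice (.ite c s t) σ Q ↔
      if c.eval σ.num ≠ 0 then Runs choice s σ Q else Runs choice t σ Q := by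
  split_ifs with hc
  · exact ⟨fun ⟨_, h, hQ⟩ => by
      cases h with
      | ite_true _ h => exact ⟨_, h, hQ⟩
      | ite_false h0 => exact absurd h0 hc,
      fun ⟨_, h, hQ⟩ => ⟨_, .ite_true hc h, hQ⟩⟩
  · rw [not_not] at hc
    exact ⟨fun ⟨_, h, hQ⟩ => by
      cases h with
      | ite_true h0 => exact absurd hc h0
      | ite_false _ h => exact ⟨_, h, hQ⟩,
      fun ⟨_, h, hQ⟩ => ⟨_, .ite_false hc h, hQ⟩⟩

@[simp] theorem runs_block_nil : Runs choice (block []) σ Q ↔ Q σ := runs_skip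

@[simp] theorem runs_block_cons {l : List Stmt} :
    Runs choice (block (s :: l)) σ Q ↔ Runs choice s σ fun τ => Runs choice (block l) τ Q :=
  runs_seq

/-- The loop rule, with an invariant `I` and a variant `m`. -/
theorem runs_loop (I : State V → Prop) (m : State V → ℕ) (start : I σ)
    (step : ∀ τ, I τ → c.eval τ.num ≠ 0 → Runs choice s τ fun υ => I υ ∧ m υ < m τ)
    (exit : ∀ τ, I τ → c.eval τ.num = 0 → Q τ) : Runs choice (.loop c s) σ Q := by
  induction hk : m σ using Nat.strong_induction_on generalizing σ with
  | _ k ih =>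
    by_cases hc : c.eval σ.num = 0
    · exact ⟨σ, .loop_false hc, exit σ start hc⟩
    · obtain ⟨τ, hτ, hIτ, hlt⟩ := step σ start hc
      obtain ⟨υ, hυ, hQ⟩ := ih _ (hk ▸ hlt) hIτ rfl
      exact ⟨υ, .loop_true hc hτ hυ, hQ⟩

end Runs

/-! ## Memory layout and loops -/

-- Numeric registers; those from `7` on are scratch, and the arrays begin at address `16`.
local notation "nVertices" => 1
local notation "nBits" => 2
local notation "nThreshold" => 3
local notation "nRefreshed" => 4
local notation "nUndecided" => 5
local notation "nRoot" => 6
local notation "nCard" => 7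
local notation "nRow" => 8
local notation "nIndex" => 9
local notation "nNumber" => 10
local notation "nBit" => 11
local notation "nTest" => 12
local notation "nPower" => 13
local notation "nChanged" => 14

-- Vertex registers; the register `vBits + i` holds the vertices whose number has bit `i`.
local notation "vAll" => 0
local notation "vRandom" => 2
local notation "vUndecided" => 3
local notation "vPicked" => 4
local notation "vWorklist" => 5
local notation "vSuccessors" => 6
local notation "vComponent" => 7
local notation "vFrontier" => 8
local notation "vRest" => 9
local notation "vRemoved" => 10
local notation "vBits" => 11

-- Numeric arrays, indexed by vertex numbers except for the last one.
local notation "aDecided" => 0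
local notation "aKnown" => 1
local notation "aMarked" => 2
local notation "aEdge" => 3

/-- The address of the entry `i` of the array `k`; the four arrays are interleaved. -/
def cellAddr (k : Fin 4) (i : ℕ) : ℕ := 16 + k + 4 * i

def cell (k : Fin 4) (e : NExp) : NExp := ((16 + k : ℕ) : NExp) + 4 * e

def arrayAddrs (k : Fin 4) : Set ℕ := Set.range (cellAddr k)

section Cells

variable {k l : Fin 4} {i j a : ℕ}

@[simp] theorem eval_cell (m : ℕ → ℕ) (k : Fin 4) (e : NExp) :
    (cell k e).eval m = cellAddr k (e.eval m) := rfl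

@[simp] theorem cellAddr_inj : cellAddr k i = cellAddr l j ↔ k = l ∧ i = j := by
  simp only [cellAddr, Fin.ext_iff]
  omega

@[simp] theorem le_cellAddr (h : a ≤ 16) : a ≤ cellAddr k i := by
  simp only [cellAddr]
  omega

@[simp] theorem cellAddr_ne (h : a < 16) : cellAddr k i ≠ a := by
  simp only [cellAddr]
  omega

@[simp] theorem ne_cellAddr (h : a < 16) : a ≠ cellAddr k i := (cellAddr_ne h).symm

@[simp] theorem cellAddr_mem_arrayAddrs : cellAddr k i ∈ arrayAddrs l ↔ k = l := by
  simp [arrayAddrs, eq_comm]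

@[simp] theorem notMem_arrayAddrs (h : a < 16) : a ∉ arrayAddrs k := by
  simp [arrayAddrs, h]

@[simp] theorem forall_mem_arrayAddrs {p : ℕ → Prop} :
    (∀ a ∈ arrayAddrs k, p a) ↔ ∀ i, p (cellAddr k i) :=
  Set.forall_mem_range

end Cells

/-- Through the numbering `f`, the array `k` holds the characteristic function of `S`. -/
def Stores {V α : Type*} {n : ℕ} (σ : State V) (k : Fin 4) (f : α ≃ Fin n) (S : Finset α) : Prop :=
  ∀ a, (a ∈ S → σ.num (cellAddr k (f a)) = 1) ∧ (a ∉ S → σ.num (cellAddr k (f a)) = 0)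

namespace Stores

variable {V α : Type*} {n : ℕ} {σ τ : State V} {k : Fin 4} {f : α ≃ Fin n} {S : Finset α}

theorem num_eq_zero_iff (h : Stores σ k f S) {a : α} :
    σ.num (cellAddr k (f a)) = 0 ↔ a ∉ S := by
  by_cases ha : a ∈ S
  · simp [ha, (h a).1 ha]
  · simp [ha, (h a).2 ha]

@[simp] theorem setNum_iff {d x : ℕ} (hd : d < 16) :
    Stores (σ.setNum d x) k f S ↔ Stores σ k f S := by
  simp [Stores, Function.update_of_ne, hd]

@[simp] theorem setNum_cell_iff {l : Fin 4} {i x : ℕ} (hkl : k ≠ l) :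
    Stores (σ.setNum (cellAddr l i) x) k f S ↔ Stores σ k f S := by
  simp [Stores, Function.update_of_ne, hkl]

@[simp] theorem setVert_iff {d : ℕ} {X : Finset V} :
    Stores (σ.setVert d X) k f S ↔ Stores σ k f S := Iff.rfl

@[simp] theorem tick_iff : Stores σ.tick k f S ↔ Stores σ k f S := Iff.rfl

theorem of_frame (h : Stores σ k f S) {N W : Set ℕ} (hF : Frame N W σ τ)
    (hN : ∀ i, cellAddr k i ∉ N) : Stores τ k f S := fun a => by
  rw [hF.num _ (hN _)]
  exact h a

theorem insert [DecidableEq α] (h : Stores σ k f S) (a : α) :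
    Stores (σ.setNum (cellAddr k (f a)) 1) k f (insert a S) := fun b => by
  by_cases hab : b = a
  · simp [hab]
  · have hne : f b ≠ f a := fun h0 => hab (f.injective h0)
    simpa [hab, Function.update_apply, Fin.val_inj, hne] using h b

end Stores

variable {V : Type*} [Fintype V] [DecidableEq V] {choice : ℕ → Finset V → V}

def whileNonempty (X : ℕ) (body : Stmt) : Stmt := block [
  .sym (.card nCard X),
  .loop (reg nCard) (block [body, .sym (.card nCard X)])]

/-- The vertices of `X` are picked one after the other. -/
def forEach (X : ℕ) (body : Stmt) : Stmt :=
  whileNonempty X (block [.sym (.pick vPicked X), .sym (.vertOp .diff X X vPicked), body])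

def forRange (i : ℕ) (bound : NExp) (body : Stmt) : Stmt := block [
  .assign i 0,
  .loop (bound - reg i) (block [body, .assign i (reg i + 1)])]

section Loops

variable {X i n : ℕ} {bound : NExp} {body : Stmt} {N W : Set ℕ} {σ : State V}
  {Q : State V → Prop}

@[simp] theorem writesTo_whileNonempty :
    (whileNonempty X body).WritesTo N W ↔ nCard ∈ N ∧ body.WritesTo N W := by
  simp only [whileNonempty, block, Stmt.WritesTo, Instr.WritesTo, eval_ofNat, forall_const]
  tauto

@[simp] theorem writesTo_forEach :
    (forEach X body).WritesTo N W ↔ nCard ∈ N ∧ vPicked ∈ W ∧ X ∈ W ∧ body.WritesTo N W := by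
  simp [forEach, block, Stmt.WritesTo, Instr.WritesTo]

@[simp] theorem writesTo_forRange :
    (forRange i bound body).WritesTo N W ↔ i ∈ N ∧ body.WritesTo N W := by
  simp only [forRange, block, Stmt.WritesTo, eval_const, forall_const]
  tauto

theorem runs_whileNonempty (hbody : body.WritesTo N W) (hcard : nCard ∈ N)
    (I : State V → Prop) (m : State V → ℕ) (start : I σ)
    (step : ∀ τ, Frame N W σ τ → I τ → (τ.vert X).Nonempty →
      Runs choice body (τ.setNum nCard (τ.vert X).card).tick fun υ => I υ ∧ m υ < m τ)
    (exit : ∀ τ, Frame N W σ τ → I τ → τ.vert X = ∅ → Q (τ.setNum nCard 0).tick) :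
    Runs choice (whileNonempty X body) σ Q := by
  have loop : ∀ k τ, m τ = k → Frame N W σ τ → I τ →
      Runs choice (.loop (reg nCard) (block [body, .sym (.card nCard X)]))
        (τ.setNum nCard (τ.vert X).card).tick Q := by
    intro k
    induction k using Nat.strong_induction_on with
    | _ k ih =>
      intro τ hk hF hI
      by_cases hX : τ.vert X = ∅
      · refine ⟨_, .loop_false (by simp [hX]), ?_⟩
        simpa [hX] using exit τ hF hI hX
      · rw [← ne_eq, ← Finset.nonempty_iff_ne_empty] at hX
        obtain ⟨υ, hυ, hIυ, hlt⟩ := step τ hF hI hX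
        obtain ⟨ω, hω, hQ⟩ :=
          ih _ (hk ▸ hlt) υ rfl ((hF.setNum hcard).tick.trans (hυ.frame hbody)) hIυ
        refine ⟨ω, .loop_true (by simp [hX.ne_empty]) (.seq hυ (.seq (.sym _ _) (.skip _))) ?_, hQ⟩
        simpa only [Instr.step_eq_tick, Instr.effect, eval_ofNat, eval_const] using hω
  simp only [whileNonempty, runs_block_cons, runs_block_nil, runs_sym, Instr.effect, eval_ofNat,
    eval_const]
  exact loop _ σ rfl (.refl N W σ) start

theorem runs_forEach (hch : ∀ t X, X.Nonempty → choice t X ∈ X) (hbody : body.WritesTo N W)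
    (hcard : nCard ∈ N) (hpick : vPicked ∈ W) (hX : X ∉ W)
    (I : Finset V → State V → Prop) (start : I ∅ σ)
    (step : ∀ D v τ τ', v ∈ σ.vert X \ D → Frame N (insert X W) σ τ → I D τ →
      Frame {nCard} {X, vPicked} τ τ' → τ'.vert vPicked = {v} → τ'.ops = τ.ops + 3 →
      Runs choice body τ' (I (insert v D)))
    (exit : ∀ τ, Frame N (insert X W) σ τ → I (σ.vert X) τ → Q (τ.setNum nCard 0).tick) :
    Runs choice (forEach X body) σ Q := by
  have hXp : X ≠ vPicked := fun h => hX (h ▸ hpick)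
  have hbody' : body.WritesTo N (insert X W) := hbody.mono subset_rfl (Set.subset_insert X W)
  refine runs_whileNonempty (N := N) (W := insert X W)
    (by simp [block, Stmt.WritesTo, Instr.WritesTo, hbody', hpick]) hcard
    (fun τ => ∃ D ⊆ σ.vert X, I D τ ∧ τ.vert X = σ.vert X \ D) (fun τ => (τ.vert X).card)
    ⟨∅, by simp, start, by simp⟩ ?_ ?_
  · rintro τ hF ⟨D, hDX, hI, hD⟩ hne
    let v := choice τ.tick.ops (τ.vert X)
    have hv : v ∈ τ.vert X := hch _ _ hne
    have hvD := Finset.mem_sdiff.1 (hD ▸ hv)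
    have hpicked : Frame {nCard} {X, vPicked} τ
        ((((τ.setNum nCard (τ.vert X).card).tick.setVert vPicked {v}).tick.setVert X
          (τ.vert X \ {v})).tick) :=
      ((Frame.refl _ _ τ).setNum.tick.setVert).tick.setVert.tick
    simp only [runs_block_cons, runs_block_nil, runs_sym, Instr.effect, eval_ofNat, eval_const,
      SetOp.eval]
    have hbodyRuns := step D v τ _ (Finset.mem_sdiff.2 hvD) hF hI hpicked
      (by simp [Function.update_of_ne hXp.symm]) (by simp)
    simpa [hne, Function.update_of_ne hXp, v] using hbodyRuns.mono_frame hbody fun υ hFυ hIυ => by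
      have hυ : υ.vert X = τ.vert X \ {v} := by simp [hFυ.vert X hX]
      refine ⟨⟨insert v D, Finset.insert_subset hvD.1 hDX, hIυ, ?_⟩, ?_⟩
      · rw [hυ, hD, sdiff_sdiff, Finset.sup_eq_union, Finset.union_comm, Finset.insert_eq]
      · rw [hυ]
        exact Finset.card_lt_card (Finset.sdiff_ssubset (by simpa using hv) (by simp))
  · rintro τ hF ⟨D, hDX, hI, hD⟩ h0
    rw [hD, Finset.sdiff_eq_empty_iff_subset] at h0
    exact exit τ hF (h0.antisymm hDX ▸ hI)

theorem runs_forRange (hbody : body.WritesTo N W) (hi : i ∉ N)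
    (hbound : ∀ τ, Frame (insert i N) W σ τ → bound.eval τ.num = n)
    (I : ℕ → State V → Prop) (start : I 0 (σ.setNum i 0))
    (step : ∀ k < n, ∀ τ, Frame (insert i N) W σ τ → τ.num i = k → I k τ →
      Runs choice body τ fun υ => I (k + 1) (υ.setNum i (k + 1)))
    (exit : ∀ τ, Frame (insert i N) W σ τ → I n τ → Q τ) :
    Runs choice (forRange i bound body) σ Q := by
  have hF₀ : Frame (insert i N) W σ (σ.setNum i 0) := (Frame.refl _ _ σ).setNum
  simp only [forRange, runs_block_cons, runs_block_nil, runs_assign, eval_ofNat, eval_const]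
  refine runs_loop
    (fun τ => Frame (insert i N) W σ τ ∧ τ.num i ≤ n ∧ I (τ.num i) τ) (fun τ => n - τ.num i)
    ⟨hF₀, by simp, by simpa using start⟩ ?_ ?_
  · rintro τ ⟨hF, hle, hI⟩ hc
    simp only [eval_sub, hbound τ hF, eval_reg, eval_const] at hc
    have hlt : τ.num i < n := by omega
    simp only [runs_block_cons, runs_block_nil, runs_assign, eval_reg, eval_const, eval_add,
      eval_ofNat]
    refine (step _ hlt τ hF rfl hI).mono_frame hbody fun υ hFυ hIυ => ?_
    have hυ : υ.num i = τ.num i := hFυ.num i hi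
    have hFυ' : Frame (insert i N) W τ υ := hFυ.mono (Set.subset_insert i N) subset_rfl
    refine ⟨⟨(hF.trans hFυ').setNum, ?_, ?_⟩, ?_⟩
    · simpa [hυ] using hlt
    · simpa [hυ] using hIυ
    · simp only [hυ, State.setNum_num, Function.update_self]
      omega
  · rintro τ ⟨hF, hle, hI⟩ hc
    simp only [eval_sub, hbound τ hF, eval_reg, eval_const] at hc
    have heq : τ.num i = n := by omega
    exact exit τ hF (heq ▸ hI)

theorem runs_forRange_equiv {α : Type*} [Fintype α] [DecidableEq α] (f : α ≃ Fin n)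
    (hbody : body.WritesTo N W) (hi : i ∉ N)
    (hbound : ∀ τ, Frame (insert i N) W σ τ → bound.eval τ.num = n)
    (I : Finset α → State V → Prop) (start : I ∅ (σ.setNum i 0))
    (step : ∀ D, ∀ a ∉ D, ∀ τ, Frame (insert i N) W σ τ → τ.num i = f a → I D τ →
      Runs choice body τ fun υ => I (insert a D) (υ.setNum i (f a + 1)))
    (exit : ∀ τ, Frame (insert i N) W σ τ → I Finset.univ τ → Q τ) :
    Runs choice (forRange i bound body) σ Q := by
  let upTo (k : ℕ) : Finset α := {a | (f a : ℕ) < k}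
  refine runs_forRange hbody hi hbound (fun k => I (upTo k)) (by simpa [upTo] using start) ?_ ?_
  · intro k hk τ hF hτ hI
    have hfa : (f (f.symm ⟨k, hk⟩) : ℕ) = k := by simp
    have hsucc : upTo (k + 1) = insert (f.symm ⟨k, hk⟩) (upTo k) := by
      ext a
      simp only [upTo, Finset.mem_filter_univ, Finset.mem_insert, Equiv.eq_symm_apply, Fin.ext_iff]
      omega
    have h := step (upTo k) (f.symm ⟨k, hk⟩) (by simp [upTo]) τ hF (hτ.trans hfa.symm) hI
    rwa [hfa, ← hsucc] at h
  · intro τ hF hI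
    refine exit τ hF ?_
    rwa [show upTo n = Finset.univ by simp [upTo]] at hI

end Loops

section Identify

variable {n : ℕ} {idx : V ≃ Fin n}

/-- The vertex `v` picked last is identified by the bits of its number. -/
def identify : Stmt := block [
  .assign nNumber 0,
  .assign nPower 1,
  forRange nBit (reg nBits) (block [
    .sym (.vertTest .subset nTest vPicked (vBits + reg nBit)),
    .assign nNumber (reg nNumber + reg nTest * reg nPower),
    .assign nPower (2 * reg nPower)])]

/-- The registers `vBits + i` hold the binary digits of the numbers `idx v`. -/
structure StoresBits (idx : V ≃ Fin n) (σ : State V) : Prop where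
  le_two_pow : n ≤ 2 ^ σ.num nBits
  mem_iff : ∀ i < σ.num nBits, ∀ v, v ∈ σ.vert (vBits + i) ↔ (idx v : ℕ).testBit i

theorem runs_identify {σ : State V} {v : V} (hbits : StoresBits idx σ)
    (hv : σ.vert vPicked = {v}) :
    Runs choice identify σ fun τ => τ.num nNumber = idx v ∧ τ.ops = σ.ops + σ.num nBits := by
  simp only [identify, runs_block_cons, runs_assign]
  refine runs_forRange (N := {nTest, nNumber, nPower}) (W := ∅) (n := σ.num nBits)
    (by simp [block, Stmt.WritesTo, Instr.WritesTo]) (by simp)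
    (fun τ hF => by simp [hF.num])
    (fun k τ => τ.num nNumber = idx v % 2 ^ k ∧ τ.num nPower = 2 ^ k ∧ τ.ops = σ.ops + k)
    (by simp [Nat.mod_one]) ?_ ?_
  · rintro k hk τ hF hτ ⟨hnum, hpow, hops⟩
    have hmem := hbits.mem_iff k hk v
    have hbit : τ.vert (vBits + k) = σ.vert (vBits + k) := hF.vert _ (by simp)
    have hpicked : τ.vert vPicked = {v} := (hF.vert _ (by simp)).trans hv
    have hdigit : (idx v : ℕ) % 2 ^ (k + 1) =
        idx v % 2 ^ k + (if v ∈ σ.vert (vBits + k) then 1 else 0) * 2 ^ k := by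
      rw [Nat.mod_pow_succ, ← Nat.toNat_testBit, mul_comm]
      cases h : (idx v : ℕ).testBit k <;> simp [hmem, h]
    simp [Instr.effect, SetTest.eval, hτ, hbit, hpicked, hnum, hpow, hops, hdigit,
      (pow_succ' 2 k).symm, add_assoc]
  · rintro τ - ⟨hnum, -, hops⟩
    simpa [Nat.mod_eq_of_lt ((idx v).isLt.trans_le hbits.le_two_pow), hnum] using hops

/-- The vertex numbered `r`, where `r + 1` is the number in `nRoot`, is picked. -/
def select : Stmt := block [
  .assign nNumber (reg nRoot - 1),
  .sym (.vertOp .union vPicked vAll vAll),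
  forRange nBit (reg nBits) (block [
    .ite (reg nNumber - 2 * (reg nNumber / 2))
      (.sym (.vertOp .inter vPicked vPicked (vBits + reg nBit)))
      (.sym (.vertOp .diff vPicked vPicked (vBits + reg nBit))),
    .assign nNumber (reg nNumber / 2)])]

theorem runs_select {σ : State V} {r : V} (hbits : StoresBits idx σ)
    (hall : σ.vert vAll = Finset.univ) (hr : σ.num nRoot = idx r + 1) :
    Runs choice select σ fun τ => τ.vert vPicked = {r} ∧ τ.ops = σ.ops + (σ.num nBits + 1) := by
  simp only [select, runs_block_cons, runs_assign, runs_sym]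
  refine runs_forRange (N := {nNumber}) (W := {vPicked}) (n := σ.num nBits)
    (by simp [block, Stmt.WritesTo, Instr.WritesTo]) (by simp)
    (fun τ hF => by simp [hF.num, Instr.effect])
    (fun k τ => τ.num nNumber = idx r / 2 ^ k ∧ τ.ops = σ.ops + (k + 1) ∧
      ∀ v, v ∈ τ.vert vPicked ↔ ∀ i < k, (idx v : ℕ).testBit i = (idx r : ℕ).testBit i)
    (by simp [hr, hall, Instr.effect, SetOp.eval]) ?_ ?_
  · rintro k hk τ hF hτ ⟨hnum, hops, hpicked⟩
    have hne : vBits + k ≠ vPicked := by omega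
    have hbit : τ.vert (vBits + k) = σ.vert (vBits + k) :=
      (hF.vert _ (by simp [hne])).trans (by simp [Instr.effect, Function.update_of_ne hne])
    have hdiv : (idx r : ℕ) / 2 ^ k / 2 = idx r / 2 ^ (k + 1) := by
      rw [Nat.div_div_eq_div_mul, pow_succ]
    have hmod : (idx r : ℕ) / 2 ^ k - 2 * (idx r / 2 ^ (k + 1)) =
        ((idx r : ℕ).testBit k).toNat := by
      rw [Nat.toNat_testBit, ← hdiv]
      omega
    have hbits_succ (v : V) : (∀ i ≤ k, (idx v : ℕ).testBit i = (idx r : ℕ).testBit i) ↔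
        (∀ i < k, (idx v : ℕ).testBit i = (idx r : ℕ).testBit i) ∧
          (v ∈ σ.vert (vBits + k) ↔ (idx r : ℕ).testBit k) := by
      simp only [← Nat.lt_add_one_iff, Nat.forall_lt_succ_right, hbits.mem_iff k hk v,
        ← Bool.eq_iff_iff]
    simp only [runs_block_cons, runs_block_nil, runs_assign, runs_sym, runs_ite]
    cases h : (idx r : ℕ).testBit k <;>
      simp [Instr.effect, SetOp.eval, hnum, hdiv, hmod, hpicked, hops, hτ, hbit, h, hbits_succ,
        add_assoc]
  · rintro τ - ⟨-, hops, hpicked⟩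
    refine runs_block_nil.2 ⟨?_, by rw [hops]⟩
    have hlt (v : V) (i : ℕ) (hi : σ.num nBits ≤ i) : (idx v : ℕ).testBit i = false :=
      Nat.testBit_lt_two_pow <| (idx v).isLt.trans_le <|
        hbits.le_two_pow.trans <| Nat.pow_le_pow_right two_pos hi
    ext v
    rw [hpicked, Finset.mem_singleton]
    refine ⟨fun h => ?_, fun h i _ => by rw [h]⟩
    refine idx.injective <| Fin.ext <| Nat.eq_of_testBit_eq fun i => ?_
    rcases lt_or_ge i (σ.num nBits) with hi | hi
    · exact h i hi
    · rw [hlt v i hi, hlt r i hi]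

end Identify

/-! ## Searches by symbolic operations -/

@[simp] theorem mem_pre {E : Finset (V × V)} {S : Finset V} {v : V} :
    v ∈ pre E S ↔ ∃ w ∈ S, (v, w) ∈ E := by
  simp [pre]

@[simp] theorem mem_post {E : Finset (V × V)} {S : Finset V} {v : V} :
    v ∈ post E S ↔ ∃ w ∈ S, (w, v) ∈ E := by
  simp [post]

variable {P : MDP V}

section ForwardSearch

/-- A stage of the search forward from `r` in the subgraph induced by `A`: the vertices in `C` have
been reached, and the successors of those in `F` are still to be visited. -/
structure ForwardSearch (P : MDP V) (A : Finset V) (r : V) (C F : Finset V) : Prop where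
  mem : r ∈ C
  frontier_subset : F ⊆ C
  reach : ∀ v ∈ C, P.Reach A r v
  visited : ∀ a ∈ C, a ∉ F → ∀ b ∈ A, (a, b) ∈ P.edges → b ∈ C

namespace ForwardSearch

variable {A C F : Finset V} {r : V}

theorem start (P : MDP V) (A : Finset V) (r : V) : ForwardSearch P A r {r} {r} := by
  constructor <;> simp [MDP.Reach, Relation.ReflTransGen.refl]

theorem step (h : ForwardSearch P A r C F) (hr : r ∈ A) :
    ForwardSearch P A r (C ∪ post P.edges F ∩ A) ((post P.edges F ∩ A) \ C) where
  mem := Finset.mem_union_left _ h.mem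
  frontier_subset := Finset.sdiff_subset.trans Finset.subset_union_right
  reach v hv := by
    simp only [Finset.mem_union, Finset.mem_inter, mem_post] at hv
    rcases hv with hv | ⟨⟨w, hwF, hwv⟩, hvA⟩
    · exact h.reach v hv
    · have hrw := h.reach w (h.frontier_subset hwF)
      exact hrw.tail ⟨hrw.mem hr, hvA, hwv⟩
  visited a ha haF b hb hab := by
    simp only [Finset.mem_union, Finset.mem_sdiff,
      Finset.mem_inter, mem_post] at ha haF ⊢
    by_cases haF' : a ∈ F
    · exact .inr ⟨⟨a, haF', hab⟩, hb⟩
    · exact .inl (h.visited a (ha.elim id fun h' => not_not.1 fun hC => haF ⟨h', hC⟩) haF' b hb hab)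

theorem subset_reachSet (h : ForwardSearch P A r C F) : C ⊆ P.reachSet A r :=
  fun v hv => MDP.mem_reachSet.2 (h.reach v hv)

theorem eq_reachSet (h : ForwardSearch P A r C ∅) : C = P.reachSet A r := by
  have hC : P.IsTrap A C := fun a ha => h.visited a ha (Finset.notMem_empty a)
  exact h.subset_reachSet.antisymm fun v hv => hC.mem_of_reach h.mem (MDP.mem_reachSet.1 hv)

end ForwardSearch

def component : Stmt := block [
  .sym (.vertOp .union vComponent vPicked vPicked),
  .sym (.vertOp .union vFrontier vPicked vPicked),
  whileNonempty vFrontier (block [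
    .sym (.post vFrontier 0 vFrontier),
    .sym (.vertOp .inter vFrontier vFrontier vUndecided),
    .sym (.vertOp .diff vFrontier vFrontier vComponent),
    .sym (.vertOp .union vComponent vComponent vFrontier)])]

theorem runs_component {σ : State V} {A : Finset V} {r : V} (hE : σ.edge 0 = P.edges)
    (hA : σ.vert vUndecided = A) (hp : σ.vert vPicked = {r}) (hr : r ∈ A) :
    Runs choice component σ fun τ => τ.vert vComponent = P.reachSet A r ∧
      τ.ops ≤ σ.ops + 3 + 5 * (P.reachSet A r).card := by
  simp only [component, runs_block_cons, runs_sym, runs_block_nil]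
  refine runs_whileNonempty (N := {nCard}) (W := {vComponent, vFrontier})
    (by simp [block, Stmt.WritesTo, Instr.WritesTo]) (by simp)
    (fun τ => ForwardSearch P A r (τ.vert vComponent) (τ.vert vFrontier) ∧
      τ.ops + 5 * (τ.vert vFrontier).card ≤ σ.ops + 2 + 5 * (τ.vert vComponent).card)
    (fun τ => (P.reachSet A r).card - (τ.vert vComponent).card + (τ.vert vFrontier).card)
    (by simpa [hp] using .start P A r) ?_ ?_
  · rintro τ hF ⟨hS, hops⟩ hne
    have hundec : τ.vert vUndecided = A := by simpa [hF.vert] using hA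
    have hedge : τ.edge 0 = P.edges := by simpa [hF.edge] using hE
    have hstep := hS.step hr
    have hle := Finset.card_le_card hstep.subset_reachSet
    have hcard := Finset.card_sdiff_add_card (post P.edges (τ.vert vFrontier) ∩ A)
      (τ.vert vComponent)
    rw [Finset.union_comm] at hcard
    have hpos := hne.card_pos
    simp [hedge, hundec, hstep]
    omega
  · rintro τ - ⟨hS, hops⟩ h0
    have hC := (h0 ▸ hS).eq_reachSet
    simp [hC, h0] at hops ⊢
    omega

end ForwardSearch

section BackwardSearch

/-- A stage of the search backward from `r` within the trap `T₀` of the subgraph induced by `A`: the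
vertices of `T₀` outside `T` have been visited, and those in `F` are to be visited next. -/
structure BackwardSearch (P : MDP V) (A T₀ : Finset V) (r : V) (T F : Finset V) : Prop where
  subset : T ⊆ T₀
  frontier_subset : F ⊆ T
  found : r ∈ T → r ∈ F
  reach : ∀ v ∈ T₀, v ∉ T ∨ v ∈ F → P.Reach A v r
  unvisited : ∀ a ∈ T, a ∉ F → ∀ b ∈ A, (a, b) ∈ P.edges → b ∈ T

namespace BackwardSearch

variable {A T₀ T F : Finset V} {r : V}

theorem start (hT₀ : P.IsTrap A T₀) (hr : r ∈ T₀) : BackwardSearch P A T₀ r T₀ {r} where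
  subset := subset_rfl
  frontier_subset := Finset.singleton_subset_iff.2 hr
  found _ := Finset.mem_singleton_self r
  reach v hv h := by
    rw [Finset.mem_singleton.1 (h.resolve_left (not_not.2 hv))]
    exact .refl
  unvisited a ha _ := hT₀ a ha

theorem step (h : BackwardSearch P A T₀ r T F) (hT₀ : T₀ ⊆ A) :
    BackwardSearch P A T₀ r (T \ F) (pre P.edges F ∩ (T \ F)) where
  subset := Finset.sdiff_subset.trans h.subset
  frontier_subset := Finset.inter_subset_right
  found hr := absurd (h.found (Finset.mem_sdiff.1 hr).1) (Finset.mem_sdiff.1 hr).2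
  reach v hv hvT := by
    simp only [Finset.mem_inter, Finset.mem_sdiff, mem_pre] at hvT
    rcases hvT with hvT | ⟨⟨w, hwF, hvw⟩, -⟩
    · exact h.reach v hv (by tauto)
    · have hwT₀ := h.subset (h.frontier_subset hwF)
      exact (h.reach w hwT₀ (.inr hwF)).head ⟨hT₀ hv, hT₀ hwT₀, hvw⟩
  unvisited a ha haF b hb hab := by
    have hbT := h.unvisited a (Finset.mem_sdiff.1 ha).1 (Finset.mem_sdiff.1 ha).2 b hb hab
    refine Finset.mem_sdiff.2 ⟨hbT, fun hbF => haF ?_⟩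
    exact Finset.mem_inter.2 ⟨mem_pre.2 ⟨b, hbF, hab⟩, ha⟩

theorem isTrap (h : BackwardSearch P A T₀ r T ∅) : P.IsTrap A T :=
  fun a ha => h.unvisited a ha (Finset.notMem_empty a)

theorem ssubset (h : BackwardSearch P A T₀ r T ∅) (hr : r ∈ T₀) : T ⊂ T₀ :=
  h.subset.ssubset_of_mem_notMem hr fun hrT => Finset.notMem_empty r (h.found hrT)

theorem isRoot (h : BackwardSearch P A T₀ r ∅ ∅) (hT₀ : P.IsTrap A T₀) (hT₀A : T₀ ⊆ A)
    (hr : r ∈ T₀) : P.IsRoot A r :=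
  hT₀.isRoot (hT₀A hr) hr fun v hv => h.reach v hv (.inl (Finset.notMem_empty v))

end BackwardSearch

def visitBackward : Stmt := whileNonempty vFrontier (block [
  .sym (.vertOp .diff vWorklist vWorklist vFrontier),
  .sym (.pre vFrontier 0 vFrontier),
  .sym (.vertOp .inter vFrontier vFrontier vWorklist)])

theorem runs_visitBackward {σ : State V} {A T₀ : Finset V} {r : V} (hE : σ.edge 0 = P.edges)
    (hT₀ : T₀ ⊆ A) (hS : BackwardSearch P A T₀ r (σ.vert vWorklist) (σ.vert vFrontier)) :
    Runs choice visitBackward σ fun τ =>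
      BackwardSearch P A T₀ r (τ.vert vWorklist) ∅ ∧
      τ.ops + 4 * (τ.vert vWorklist).card ≤ σ.ops + 4 * (σ.vert vWorklist).card + 1 := by
  refine runs_whileNonempty (N := {nCard}) (W := {vWorklist, vFrontier})
    (by simp [block, Stmt.WritesTo, Instr.WritesTo]) (by simp)
    (fun τ => BackwardSearch P A T₀ r (τ.vert vWorklist) (τ.vert vFrontier) ∧
      τ.ops + 4 * (τ.vert vWorklist).card ≤ σ.ops + 4 * (σ.vert vWorklist).card)
    (fun τ => (τ.vert vWorklist).card) ⟨hS, le_rfl⟩ ?_ ?_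
  · rintro τ hF ⟨hS, hops⟩ hne
    have hedge : τ.edge 0 = P.edges := by simpa [hF.edge] using hE
    have hstep := hS.step hT₀
    have hcard := Finset.card_sdiff_add_card_eq_card hS.frontier_subset
    have hpos := hne.card_pos
    simp [hedge, hstep]
    omega
  · rintro τ - ⟨hS, hops⟩ h0
    rw [h0] at hS
    simp [hS]
    omega

/-- As long as the worklist is not exhausted, one of its vertices is picked, and all the vertices
that reach it are removed. -/
def searchRoot : Stmt := block [
  .sym (.vertOp .union vWorklist vUndecided vUndecided),
  whileNonempty vWorklist (block [
    .sym (.pick vPicked vWorklist),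
    .sym (.vertOp .union vFrontier vPicked vPicked),
    visitBackward])]

theorem runs_searchRoot {σ : State V} {A : Finset V}
    (hch : ∀ t X, X.Nonempty → choice t X ∈ X) (hE : σ.edge 0 = P.edges)
    (hA : σ.vert vUndecided = A) (hne : A.Nonempty) :
    Runs choice searchRoot σ fun τ =>
      (∃ r, τ.vert vPicked = {r} ∧ P.IsRoot A r) ∧ τ.ops ≤ σ.ops + 2 + 8 * A.card := by
  simp only [searchRoot, runs_block_cons, runs_sym, runs_block_nil]
  refine runs_whileNonempty (N := {nCard}) (W := {vPicked, vWorklist, vFrontier})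
    (by simp [visitBackward, block, Stmt.WritesTo, Instr.WritesTo]) (by simp)
    (fun τ => P.IsTrap A (τ.vert vWorklist) ∧ τ.vert vWorklist ⊆ A ∧
      (τ.vert vWorklist = ∅ → ∃ r, τ.vert vPicked = {r} ∧ P.IsRoot A r) ∧
      τ.ops + 8 * (τ.vert vWorklist).card ≤ σ.ops + 1 + 8 * A.card)
    (fun τ => (τ.vert vWorklist).card) ?_ ?_ ?_
  · simp [MDP.IsTrap.self, hne.ne_empty, hA]
  · rintro τ hF ⟨htrap, hsub, -, hops⟩ hne
    have hr := hch (τ.ops + 1) _ hne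
    simp only [runs_block_cons, runs_sym, runs_block_nil]
    refine (runs_visitBackward (P := P) (A := A) (T₀ := τ.vert vWorklist)
      (r := choice (τ.ops + 1) (τ.vert vWorklist)) (by simpa [hF.edge] using hE) hsub
      (by simpa [hne] using .start htrap hr)).mono_frame
      (N := {nCard}) (W := {vWorklist, vFrontier})
      (by simp [visitBackward, block, Stmt.WritesTo, Instr.WritesTo]) fun υ hFυ ⟨hS, hυ⟩ => ?_
    have hlt := Finset.card_lt_card (hS.ssubset hr)
    simp [hne] at hυ
    refine ⟨⟨hS.isTrap, hS.subset.trans hsub, fun h0 => ?_, by omega⟩, hlt⟩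
    exact ⟨_, by simp [hFυ.vert, hne], (h0 ▸ hS).isRoot htrap hsub hr⟩
  · rintro τ - ⟨-, -, hroot, hops⟩ h0
    simp [hroot h0, h0] at hops ⊢
    omega

end BackwardSearch

section RemoveComponent

/-- The component and its random attractor are moved from `vUndecided` to `vRemoved`. -/
def removeComponent : Stmt := block [
  .sym (.vertOp .union vRemoved vUndecided vUndecided),
  .sym (.vertOp .diff vUndecided vUndecided vComponent),
  .sym (.vertOp .union vFrontier vComponent vComponent),
  whileNonempty vFrontier (block [
    .sym (.pre vFrontier 0 vFrontier),
    .sym (.vertOp .inter vFrontier vFrontier vRandom),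
    .sym (.vertOp .inter vFrontier vFrontier vUndecided),
    .sym (.vertOp .diff vUndecided vUndecided vFrontier),
    .sym (.vertOp .union vRest vRest vFrontier)]),
  .sym (.vertOp .diff vRemoved vRemoved vUndecided)]

theorem runs_removeComponent {σ : State V} {A C : Finset V} {out : List (Finset V)}
    (hE : σ.edge 0 = P.edges) (hrandom : σ.vert vRandom = P.random)
    (hA : σ.vert vUndecided = A) (hC : σ.vert vComponent = C) (hne : C.Nonempty) (hCA : C ⊆ A)
    (hdec : P.PartialDecomposition (A \ C) C (σ.vert vRest) out) :
    Runs choice removeComponent σ fun τ =>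
      P.PartialDecomposition (τ.vert vUndecided) ∅ (τ.vert vRest) out ∧
      τ.vert vUndecided ⊂ A ∧ τ.vert vRemoved = A \ τ.vert vUndecided ∧
      τ.ops + 6 * (τ.vert vUndecided).card ≤ σ.ops + 5 + 6 * A.card := by
  simp only [removeComponent, runs_block_cons, runs_sym, runs_block_nil]
  refine runs_whileNonempty (N := {nCard}) (W := {vUndecided, vFrontier, vRest})
    (by simp [block, Stmt.WritesTo, Instr.WritesTo]) (by simp)
    (fun τ => P.PartialDecomposition (τ.vert vUndecided) (τ.vert vFrontier) (τ.vert vRest) out ∧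
      τ.vert vUndecided ⊂ A ∧ τ.ops + 6 * (τ.vert vUndecided).card + 6 * (τ.vert vFrontier).card ≤
        σ.ops + 3 + 6 * A.card)
    (fun τ => (τ.vert vUndecided).card + (τ.vert vFrontier).card) ?_ ?_ ?_
  · have hcard := Finset.card_sdiff_add_card_eq_card hCA
    simp [hdec, hA, hC, Finset.sdiff_ssubset hCA hne]
    omega
  · rintro τ hF ⟨hdec, hlt, hops⟩ hne
    have hedge : τ.edge 0 = P.edges := by simpa [hF.edge] using hE
    have hrand : τ.vert vRandom = P.random := by simpa [hF.vert] using hrandom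
    have hstep := hdec.removeAttracted
    have hlt' := (Finset.sdiff_subset (s := τ.vert vUndecided)
      (t := pre P.edges (τ.vert vFrontier) ∩ P.random ∩ τ.vert vUndecided)).trans_ssubset hlt
    have hcard := Finset.card_sdiff_add_card_eq_card (t := τ.vert vUndecided)
      (s := pre P.edges (τ.vert vFrontier) ∩ P.random ∩ τ.vert vUndecided)
      Finset.inter_subset_right
    have hpos := hne.card_pos
    simp [hedge, hrand, hstep, hlt', -Finset.inter_assoc, -Finset.sdiff_inter_self_right]
    omega
  · rintro τ hF ⟨hdec, hlt, hops⟩ h0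
    rw [h0] at hdec
    simp [hF.vert, hdec, hlt, hA, h0] at hops ⊢
    omega

end RemoveComponent

/-! ## The known part of the graph -/

section Known

variable {P : MDP V} {A K : Finset V} {F : Finset (V × V)} {n L h : ℕ} {idx : V ≃ Fin n}
  {σ τ : State V}

/-- The part of the memory that is set up at the beginning. -/
structure Env (P : MDP V) (idx : V ≃ Fin n) (L h : ℕ) (σ : State V) : Prop where
  edges : σ.edge 0 = P.edges
  all : σ.vert vAll = Finset.univ
  random : σ.vert vRandom = P.random
  vertices : σ.num nVertices = n
  numBits : σ.num nBits = L
  threshold : σ.num nThreshold = h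
  bits : StoresBits idx σ
  vertRegs_le : σ.vertRegs ≤ 11 + L
  edgeRegs : σ.edgeRegs = 1

theorem StoresBits.of_frame {V : Type*} {idx : V ≃ Fin n} {σ τ : State V} {N W : Set ℕ}
    (h : StoresBits idx σ) (hF : Frame N W σ τ)
    (hN : nBits ∉ N) (hW : ∀ a ∈ W, a < vBits) : StoresBits idx τ where
  le_two_pow := hF.num _ hN ▸ h.le_two_pow
  mem_iff i hi v := by
    rw [hF.num _ hN] at hi
    rw [hF.vert _ fun ha => absurd (hW _ ha) (by omega)]
    exact h.mem_iff i hi v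

theorem Env.of_frame {N W : Set ℕ} (he : Env P idx L h σ) (hF : Frame N W σ τ)
    (hN : ∀ a ∈ N, 4 ≤ a) (hW : ∀ a ∈ W, 3 ≤ a ∧ a < vBits) : Env P idx L h τ where
  edges := hF.edge ▸ he.edges
  all := (hF.vert _ fun ha => absurd (hW _ ha) (by omega)).trans he.all
  random := (hF.vert _ fun ha => absurd (hW _ ha) (by omega)).trans he.random
  vertices := (hF.num _ fun ha => absurd (hN _ ha) (by omega)).trans he.vertices
  numBits := (hF.num _ fun ha => absurd (hN _ ha) (by omega)).trans he.numBits
  threshold := (hF.num _ fun ha => absurd (hN _ ha) (by omega)).trans he.threshold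
  bits := he.bits.of_frame hF (fun ha => absurd (hN _ ha) (by omega)) fun a ha => (hW a ha).2
  vertRegs_le := hF.vertRegs_le _ (fun a ha => (hW a ha).2.trans_le le_self_add) he.vertRegs_le
  edgeRegs := hF.edgeRegs.trans he.edgeRegs

/-- The pair `(v, w)` has the number `idx w + n * idx v`. -/
def pairIdx {V : Type*} (idx : V ≃ Fin n) : V × V ≃ Fin (n * n) :=
  (idx.prodCongr idx).trans finProdFinEquiv

@[simp] theorem pairIdx_apply {V : Type*} {idx : V ≃ Fin n} (v w : V) :
    (pairIdx idx (v, w) : ℕ) = idx w + n * idx v := rfl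

/-- The edges in `F` have been learned, among them all the edges of the subgraph induced by `A`
that leave a vertex of `K`. -/
structure KnownGraph (P : MDP V) (A K : Finset V) (F : Finset (V × V)) : Prop where
  subset : F ⊆ P.edges
  mem : ∀ v ∈ K, ∀ w ∈ A, (v, w) ∈ P.edges → (v, w) ∈ F

namespace KnownGraph

theorem empty (P : MDP V) (A : Finset V) : KnownGraph P A ∅ ∅ := by
  constructor <;> simp

theorem anti {B : Finset V} (hk : KnownGraph P A K F) (hBA : B ⊆ A) : KnownGraph P B K F :=
  ⟨hk.subset, fun v hv w hw => hk.mem v hv w (hBA hw)⟩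

theorem insert (hk : KnownGraph P A K F) (v : V) :
    KnownGraph P A (insert v K) (F ∪ {v} ×ˢ (post P.edges {v} ∩ A)) where
  subset := Finset.union_subset hk.subset fun ⟨u, w⟩ h => by
    simp only [Finset.mem_product, Finset.mem_singleton, Finset.mem_inter, mem_post,
      exists_eq_left] at h
    exact h.1 ▸ h.2.1
  mem u hu w hw huw := by
    rcases Finset.mem_insert.1 hu with rfl | hu
    · exact Finset.mem_union_right _ (by simp [huw, hw])
    · exact Finset.mem_union_left _ (hk.mem u hu w hw huw)

end KnownGraph

/-- The arrays of the known vertices and edges hold a known part of the graph. -/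
structure StoresGraph (P : MDP V) (idx : V ≃ Fin n) (A K : Finset V) (F : Finset (V × V))
    (σ : State V) : Prop where
  known : Stores σ aKnown idx K
  edges : Stores σ aEdge (pairIdx idx) F
  graph : KnownGraph P A K F

theorem StoresGraph.of_frame {N W : Set ℕ} (hG : StoresGraph P idx A K F σ) (hF : Frame N W σ τ)
    (hN : ∀ i, cellAddr aKnown i ∉ N ∧ cellAddr aEdge i ∉ N) : StoresGraph P idx A K F τ where
  known := hG.known.of_frame hF fun i => (hN i).1
  edges := hG.edges.of_frame hF fun i => (hN i).2
  graph := hG.graph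

def storeEach (X : ℕ) (k : Fin 4) (e : NExp) : Stmt :=
  forEach X (block [identify, .assign (cell k e) 1])

/-- The numeric registers written by `storeEach _ k _`. -/
def storeEachNums (k : Fin 4) : Set ℕ := {nCard, nNumber, nBit, nTest, nPower} ∪ arrayAddrs k

@[simp] theorem writesTo_identify {N W : Set ℕ} :
    identify.WritesTo N W ↔ {nNumber, nBit, nTest, nPower} ⊆ N := by
  simp only [identify, block, Stmt.WritesTo, Instr.WritesTo, writesTo_forRange, eval_ofNat,
    Set.insert_subset_iff, Set.singleton_subset_iff, forall_const]
  tauto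

@[simp] theorem writesTo_storeEach {X : ℕ} {k : Fin 4} {e : NExp} :
    (storeEach X k e).WritesTo (storeEachNums k) {X, vPicked} := by
  simp [storeEach, storeEachNums, block, Stmt.WritesTo, Set.insert_subset_iff]

theorem runs_storeEach {α : Type*} [DecidableEq α] {m : ℕ} {f : α ≃ Fin m} {g : V → α} {X : ℕ}
    {k : Fin 4} {e : NExp} {S : Finset α} (hch : ∀ t X, X.Nonempty → choice t X ∈ X)
    (henv : Env P idx L h σ) (hX : 3 ≤ X ∧ X < vBits) (hXp : X ≠ vPicked)
    (he : ∀ τ w, Frame (storeEachNums k) {X, vPicked} σ τ → τ.num nNumber = idx w →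
      e.eval τ.num = f (g w))
    (hS : Stores σ k f S) :
    Runs choice (storeEach X k e) σ fun τ => Stores τ k f (S ∪ (σ.vert X).image g) ∧
      τ.ops = σ.ops + 1 + (L + 3) * (σ.vert X).card := by
  refine runs_forEach (N := storeEachNums k) (W := {vPicked}) hch
    (by simp [storeEachNums, block, Stmt.WritesTo, Set.insert_subset_iff])
    (by simp [storeEachNums]) (by simp) (by simpa using hXp)
    (fun D τ => Stores τ k f (S ∪ D.image g) ∧ τ.ops = σ.ops + (L + 3) * D.card)
    (by simpa using hS) ?_ ?_
  · rintro D w τ τ' hw hF ⟨hD, hops⟩ hF' hp hops'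
    have hFτ' : Frame (storeEachNums k) {X, vPicked} σ τ' :=
      hF.trans (hF'.mono (by simp [storeEachNums]) subset_rfl)
    have henv' : Env P idx L h τ' :=
      henv.of_frame hFτ' (by simp [storeEachNums, or_imp, forall_and]) (by simpa using hX)
    simp only [runs_block_cons, runs_block_nil, runs_assign]
    refine (runs_identify henv'.bits hp).mono_frame (N := {nNumber, nBit, nTest, nPower}) (W := ∅)
      (by simp) fun υ hFυ ⟨hυ, hυops⟩ => ?_
    have hFσυ : Frame (storeEachNums k) {X, vPicked} σ υ :=
      hFτ'.trans (hFυ.mono (by simp [storeEachNums, Set.insert_subset_iff]) (by simp))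
    have hDυ := (hD.of_frame hF' (by simp)).of_frame hFυ (by simp)
    have hcard : (insert w D).card = D.card + 1 :=
      Finset.card_insert_of_notMem (Finset.mem_sdiff.1 hw).2
    refine ⟨?_, ?_⟩
    · simpa only [eval_cell, eval_ofNat, he υ w hFσυ hυ, Finset.image_insert, Finset.union_insert]
        using hDυ.insert (g w)
    · simp only [State.setNum_ops, hυops, hops', hops, hcard, henv'.numBits]
      ring
  · rintro τ - ⟨hD, hops⟩
    refine ⟨by simpa using hD, ?_⟩
    simp only [State.setNum_ops, State.tick_ops, hops]
    ring

def readRow : Stmt := block [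
  .assign nRow (reg nNumber),
  .sym (.post vSuccessors 0 vPicked),
  .sym (.vertOp .inter vSuccessors vSuccessors vUndecided),
  .sym (.card nCard vSuccessors)]

def storeRow : Stmt := block [
  storeEach vSuccessors aEdge (reg nNumber + reg nVertices * reg nRow),
  .assign (cell aKnown (reg nRow)) 1]

/-- The edges from the vertex picked last, whose number is in `nNumber`, to undecided vertices are
stored if there are at most `2 * h` of them, where `h` is the number in `nThreshold`. -/
def learnRow : Stmt := block [
  readRow,
  .ite (reg nCard - 2 * reg nThreshold) .skip storeRow]

theorem runs_storeRow {v : V} {X : Finset V} (hch : ∀ t X, X.Nonempty → choice t X ∈ X)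
    (henv : Env P idx L h σ) (hK : Stores σ aKnown idx K) (hF : Stores σ aEdge (pairIdx idx) F)
    (hX : σ.vert vSuccessors = X) (hrow : σ.num nRow = idx v) :
    Runs choice storeRow σ fun τ => Stores τ aKnown idx (insert v K) ∧
      Stores τ aEdge (pairIdx idx) (F ∪ {v} ×ˢ X) ∧ τ.ops = σ.ops + 1 + (L + 3) * X.card := by
  simp only [storeRow, runs_block_cons, runs_block_nil, runs_assign]
  refine (runs_storeEach (g := fun w => (v, w)) hch henv (by simp) (by simp) (fun τ w hτ hw => ?_)
    hF).mono_frame writesTo_storeEach fun τ hτ ⟨hS, hops⟩ => ?_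
  · have hrow' : τ.num nRow = idx v := by simp [hτ.num, storeEachNums, hrow]
    have hn : τ.num nVertices = n := by simp [hτ.num, storeEachNums, henv.vertices]
    simp [hw, hrow', hn]
  · have hrow' : τ.num nRow = idx v := by simp [hτ.num, storeEachNums, hrow]
    rw [hX] at hS hops
    refine ⟨?_, ?_, hops⟩
    · simpa [hrow'] using (hK.of_frame hτ (by simp [storeEachNums])).insert v
    · simpa [Finset.singleton_product, Finset.map_eq_image] using hS

theorem runs_learnRow {v : V} (hch : ∀ t X, X.Nonempty → choice t X ∈ X)
    (henv : Env P idx L h σ) (hA : σ.vert vUndecided = A) (hG : StoresGraph P idx A K F σ)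
    (hv : v ∈ A \ K) (hp : σ.vert vPicked = {v}) (hnum : σ.num nNumber = idx v) :
    Runs choice learnRow σ fun τ => ∃ K' F', StoresGraph P idx A K' F' τ ∧ K ⊆ K' ∧
      (v ∉ K' → 2 * h < (post P.edges {v} ∩ A).card) ∧
      τ.ops + (L + 3) * (2 * h) * (A \ K').card ≤
        σ.ops + 4 + (L + 3) * (2 * h) * (A \ K).card := by
  have hread : Runs choice readRow σ fun τ => τ.num nRow = idx v ∧
      τ.vert vSuccessors = post P.edges {v} ∩ A ∧ τ.num nCard = (post P.edges {v} ∩ A).card ∧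
      τ.ops = σ.ops + 3 := by
    simp [readRow, hnum, henv.edges, hp, hA]
  simp only [learnRow, runs_block_cons, runs_block_nil]
  refine hread.mono_frame (N := {nRow, nCard}) (W := {vSuccessors})
    (by simp [readRow, block, Stmt.WritesTo, Instr.WritesTo])
    fun τ hF ⟨hrow, hsucc, hcard, hops⟩ => runs_ite.2 ?_
  have henv' := henv.of_frame hF (by simp) (by simp)
  have hG' := hG.of_frame hF (by simp)
  simp only [eval_sub, eval_reg, eval_mul, eval_ofNat, hcard, henv'.threshold]
  split_ifs with hlarge
  · exact runs_skip.2 ⟨K, F, hG', subset_rfl, fun _ => by omega, by omega⟩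
  · refine (runs_storeRow hch henv' hG'.known hG'.edges hsucc hrow).mono
      fun υ ⟨hknown, hedges, hopsυ⟩ => ⟨insert v K, _, ⟨hknown, hedges, hG.graph.insert v⟩,
        Finset.subset_insert v K,
        fun hv => absurd (Finset.mem_insert_self v K) hv, ?_⟩
    have hle : (post P.edges {v} ∩ A).card ≤ 2 * h := by omega
    have hdrop : (A \ insert v K).card + 1 = (A \ K).card := by
      rw [Finset.sdiff_insert, Finset.card_erase_add_one hv]
    rw [← hdrop, hopsυ, hops]
    have := Nat.mul_le_mul_left (L + 3) hle
    linarith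

def learnIfUnknown : Stmt := block [
  identify,
  .ite (reg (cell aKnown (reg nNumber))) .skip learnRow]

theorem runs_learnIfUnknown {v : V} (hch : ∀ t X, X.Nonempty → choice t X ∈ X)
    (henv : Env P idx L h σ) (hA : σ.vert vUndecided = A) (hG : StoresGraph P idx A K F σ)
    (hv : v ∈ A) (hp : σ.vert vPicked = {v}) :
    Runs choice learnIfUnknown σ fun τ => ∃ K' F', StoresGraph P idx A K' F' τ ∧ K ⊆ K' ∧
      (v ∉ K' → 2 * h < (post P.edges {v} ∩ A).card) ∧
      τ.ops + (L + 3) * (2 * h) * (A \ K').card ≤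
        σ.ops + L + 4 + (L + 3) * (2 * h) * (A \ K).card := by
  simp only [learnIfUnknown, runs_block_cons, runs_block_nil]
  refine (runs_identify henv.bits hp).mono_frame (N := {nNumber, nBit, nTest, nPower}) (W := ∅)
    (by simp) fun τ hF ⟨hnum, hops⟩ => runs_ite.2 ?_
  rw [henv.numBits] at hops
  have hG' := hG.of_frame hF (by simp)
  simp only [eval_reg, eval_cell, eval_ofNat, hnum, ne_eq, hG'.known.num_eq_zero_iff, not_not]
  split_ifs with hknown
  · exact runs_skip.2 ⟨K, F, hG', subset_rfl, fun h0 => absurd hknown h0, by omega⟩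
  · refine (runs_learnRow hch (henv.of_frame hF (by simp) (by simp)) (by simp [hF.vert, hA]) hG'
      (Finset.mem_sdiff.2 ⟨hv, hknown⟩) (by simp [hF.vert, hp]) hnum).mono
      fun υ ⟨K', F', hGυ, hK, hlarge, hυ⟩ => ⟨K', F', hGυ, hK, hlarge, by omega⟩

/-- The rows of the unknown vertices in `vUndecided` are learned again. -/
def refresh : Stmt := block [
  .sym (.vertOp .union vWorklist vUndecided vUndecided),
  forEach vWorklist learnIfUnknown]

/-- The numeric registers written by `refresh`. -/
def refreshNums : Set ℕ :=
  {nCard, nRow, nNumber, nBit, nTest, nPower} ∪ arrayAddrs aKnown ∪ arrayAddrs aEdge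

@[simp] theorem writesTo_learnIfUnknown :
    learnIfUnknown.WritesTo refreshNums {vPicked, vSuccessors} := by
  have hstore {e : NExp} :
      (storeEach vSuccessors aEdge e).WritesTo refreshNums {vPicked, vSuccessors} := by
    refine writesTo_storeEach.mono ?_ (Set.pair_comm _ _).subset
    simp only [storeEachNums, refreshNums, Set.union_subset_iff, Set.insert_subset_iff]
    simp [Set.subset_def]
  simp only [refreshNums] at hstore
  simp [hstore, learnIfUnknown, learnRow, readRow, storeRow, refreshNums, block, Stmt.WritesTo,
    Instr.WritesTo, Set.insert_subset_iff]

@[simp] theorem writesTo_refresh :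
    refresh.WritesTo refreshNums {vWorklist, vPicked, vSuccessors} := by
  have hbody := writesTo_learnIfUnknown.mono (subset_refl refreshNums)
    (Set.subset_insert vWorklist {vPicked, vSuccessors})
  simp only [refresh, block, Stmt.WritesTo, Instr.WritesTo, writesTo_forEach, hbody]
  simp [refreshNums]

theorem runs_refresh (hch : ∀ t X, X.Nonempty → choice t X ∈ X)
    (henv : Env P idx L h σ) (hA : σ.vert vUndecided = A) (hG : StoresGraph P idx A K F σ) :
    Runs choice refresh σ fun τ => ∃ K' F', StoresGraph P idx A K' F' τ ∧
      (∀ v ∈ A \ K', 2 * h < (post P.edges {v} ∩ A).card) ∧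
      τ.ops + (L + 3) * (2 * h) * (A \ K').card ≤
        σ.ops + 2 + (L + 7) * A.card + (L + 3) * (2 * h) * (A \ K).card := by
  simp only [refresh, runs_block_cons, runs_block_nil, runs_sym]
  refine runs_forEach (N := refreshNums) (W := {vPicked, vSuccessors}) hch
    writesTo_learnIfUnknown (by simp [refreshNums]) (by simp) (by simp)
    (fun D τ => ∃ K' F', StoresGraph P idx A K' F' τ ∧
      (∀ v ∈ D, v ∉ K' → 2 * h < (post P.edges {v} ∩ A).card) ∧
      τ.ops + (L + 3) * (2 * h) * (A \ K').card ≤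
        σ.ops + 1 + (L + 7) * D.card + (L + 3) * (2 * h) * (A \ K).card) ?_ ?_ ?_
  · exact ⟨K, F, ⟨by simpa using hG.known, by simpa using hG.edges, hG.graph⟩, by simp, by simp⟩
  · rintro D v τ τ' hv hF ⟨K₁, F₁, hG₁, hD, hops⟩ hF' hp hops'
    obtain ⟨hvA, hvD⟩ := Finset.mem_sdiff.1 hv
    have hF₀ : Frame refreshNums {vWorklist, vPicked, vSuccessors} σ τ :=
      (Frame.refl _ _ σ).setVert.tick.trans hF
    have henv' : Env P idx L h τ' :=
      (henv.of_frame hF₀ (by simp [refreshNums, or_imp, forall_and]) (by simp)).of_frame hF'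
        (by simp) (by simp)
    refine (runs_learnIfUnknown hch henv' (by simp [hF'.vert, hF₀.vert, hA])
      (hG₁.of_frame hF' (by simp)) (by simpa [hA] using hvA) hp).mono
      fun υ ⟨K', F', hGυ, hK, hlarge, hυ⟩ => ⟨K', F', hGυ, ?_, ?_⟩
    · simp only [Finset.mem_insert, forall_eq_or_imp]
      exact ⟨hlarge, fun u hu huK => hD u hu fun h0 => huK (hK h0)⟩
    · rw [Finset.card_insert_of_notMem hvD]
      linarith
  · rintro τ - ⟨K', F', hG', hD, hops⟩
    refine ⟨K', F', ⟨by simpa using hG'.known, by simpa using hG'.edges, hG'.graph⟩, ?_, ?_⟩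
    · simpa [hA] using hD
    · simp [hA] at hops ⊢
      omega

end Known

/-! ## Searching the known part of the graph -/

section Saturate

variable {P : MDP V} {A K M M₀ : Finset V} {F : Finset (V × V)} {n L h : ℕ} {idx : V ≃ Fin n}
  {σ : State V}

/-- A stage of the backward search in the subgraph induced by `A`, started from the vertices in
`M₀`: so far, the vertices in `M` have been marked. -/
structure Saturation (P : MDP V) (A M₀ M : Finset V) : Prop where
  start_subset : M₀ ⊆ M
  subset : M ⊆ A
  reach : ∀ v ∈ M, ∃ u ∈ M₀, P.Reach A v u

theorem Saturation.start (P : MDP V) (h : M ⊆ A) : Saturation P A M M :=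
  ⟨subset_rfl, h, fun v hv => ⟨v, hv, .refl⟩⟩

theorem Saturation.insert (hM : Saturation P A M₀ M) {a b : V} (ha : a ∈ A) (hb : b ∈ M)
    (hab : (a, b) ∈ P.edges) : Saturation P A M₀ (insert a M) where
  start_subset := hM.start_subset.trans (Finset.subset_insert a M)
  subset := Finset.insert_subset ha hM.subset
  reach := by
    simp only [Finset.mem_insert, forall_eq_or_imp]
    obtain ⟨u, hu, hbu⟩ := hM.reach b hb
    exact ⟨⟨u, hu, hbu.head ⟨ha, hM.subset hb, hab⟩⟩, hM.reach⟩

theorem KnownGraph.isTrap_sdiff (hG : KnownGraph P A K F) (hM : A \ K ⊆ M)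
    (hclosed : ∀ a ∈ A, ∀ b ∈ M, (a, b) ∈ F → a ∈ M) : P.IsTrap A (A \ M) := by
  intro a ha b hb hab
  obtain ⟨haA, haM⟩ := Finset.mem_sdiff.1 ha
  have haK : a ∈ K := by
    by_contra haK
    exact haM (hM (Finset.mem_sdiff.2 ⟨haA, haK⟩))
  exact Finset.mem_sdiff.2 ⟨hb, fun hbM => haM (hclosed a haA b hbM (hG.mem a haK b hb hab))⟩

theorem Stores.filter_eq_compl {k : Fin 4} (hM : Stores σ k idx M) :
    Finset.univ.filter (fun v => σ.num (cellAddr k (idx v)) = 0) = Mᶜ := by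
  ext v
  simp [hM.num_eq_zero_iff]

/-- The number of the first component of the pair whose number is in `nIndex`. -/
def pairFst : NExp := reg nIndex / reg nVertices

/-- The number of the second component of the pair whose number is in `nIndex`. -/
def pairSnd : NExp := reg nIndex - reg nVertices * pairFst

theorem eval_pairFst {V : Type*} {idx : V ≃ Fin n} {m : ℕ → ℕ} {a b : V} (hn : m nVertices = n)
    (hi : m nIndex = pairIdx idx (a, b)) : pairFst.eval m = idx a := by
  have hpos : 0 < n := (idx a).pos
  simp [pairFst, hn, hi, Nat.add_mul_div_left _ _ hpos]

theorem eval_pairSnd {V : Type*} {idx : V ≃ Fin n} {m : ℕ → ℕ} {a b : V} (hn : m nVertices = n)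
    (hi : m nIndex = pairIdx idx (a, b)) : pairSnd.eval m = idx b := by
  simp [pairSnd, eval_pairFst hn hi, hn, hi]

/-- The first component of a known edge between undecided vertices is marked if the second one is
marked. -/
def markFst : Stmt :=
  .ite (reg (cell aEdge (reg nIndex)) * reg (cell aMarked pairSnd) *
      (1 - reg (cell aMarked pairFst)) * (1 - reg (cell aDecided pairFst)))
    (block [.assign (cell aMarked pairFst) 1, .assign nChanged 1]) .skip

theorem runs_markFst {a b : V} (hn : σ.num nVertices = n) (hi : σ.num nIndex = pairIdx idx (a, b))
    (hA : Stores σ aDecided idx Aᶜ) (hF : Stores σ aEdge (pairIdx idx) F)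
    (hM : Stores σ aMarked idx M) :
    Runs choice markFst σ fun τ => τ.ops = σ.ops ∧
      ((a ∈ A ∧ b ∈ M ∧ (a, b) ∈ F ∧ a ∉ M ∧ Stores τ aMarked idx (insert a M) ∧
        τ.num nChanged = 1) ∨
      ((a ∈ A → b ∈ M → (a, b) ∈ F → a ∈ M) ∧ Stores τ aMarked idx M ∧
        τ.num nChanged = σ.num nChanged)) := by
  have hcond : σ.num (cellAddr aEdge (pairIdx idx (a, b))) * σ.num (cellAddr aMarked (idx b)) *
      (1 - σ.num (cellAddr aMarked (idx a))) * (1 - σ.num (cellAddr aDecided (idx a))) ≠ 0 ↔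
        (((a, b) ∈ F ∧ b ∈ M) ∧ a ∉ M) ∧ a ∈ A := by
    simp only [ne_eq, mul_eq_zero, not_or, hF.num_eq_zero_iff, hM.num_eq_zero_iff, not_not,
      Nat.sub_eq_zero_iff_le, not_le, Nat.lt_one_iff, hA.num_eq_zero_iff, Finset.mem_compl]
  simp only [markFst, runs_ite, eval_mul, eval_sub, eval_reg, eval_cell, eval_ofNat,
    eval_pairFst hn hi, eval_pairSnd hn hi, hi, hcond]
  split_ifs with h
  · obtain ⟨⟨⟨hab, hb⟩, haM⟩, haA⟩ := h
    have hM' := hM.insert a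
    simp [eval_pairFst hn hi, haA, hb, hab, haM, hM']
  · exact runs_skip.2 ⟨rfl, .inr ⟨by tauto, hM, rfl⟩⟩

def saturateRound : Stmt := forRange nIndex (reg nVertices * reg nVertices) markFst

/-- All vertices are marked from which a marked vertex is reached along known edges. -/
def saturate : Stmt := block [
  .assign nChanged 1,
  .loop (reg nChanged) (block [.assign nChanged 0, saturateRound])]

/-- The numeric registers written by `saturate`. -/
def saturateNums : Set ℕ := {nIndex, nChanged} ∪ arrayAddrs aMarked

theorem writesTo_markFst {W : Set ℕ} :
    markFst.WritesTo ({nChanged} ∪ arrayAddrs aMarked) W := by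
  simp [markFst, block, Stmt.WritesTo]

@[simp] theorem writesTo_saturateRound {W : Set ℕ} :
    saturateRound.WritesTo saturateNums W := by
  have h : markFst.WritesTo saturateNums W :=
    writesTo_markFst.mono (by simp [saturateNums, Set.insert_subset_iff]) subset_rfl
  simpa [saturateRound, saturateNums] using h

@[simp] theorem writesTo_saturate {W : Set ℕ} : saturate.WritesTo saturateNums W := by
  simp only [saturate, block, Stmt.WritesTo, writesTo_saturateRound]
  simp [saturateNums]

theorem runs_saturateRound (hn : σ.num nVertices = n) (hA : Stores σ aDecided idx Aᶜ)
    (hF : Stores σ aEdge (pairIdx idx) F) (hFE : F ⊆ P.edges) (hM : Stores σ aMarked idx M)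
    (hsat : Saturation P A M₀ M) (hchanged : σ.num nChanged = 0) :
    Runs choice saturateRound σ fun τ => ∃ M',
      Stores τ aMarked idx M' ∧ Saturation P A M₀ M' ∧ τ.ops = σ.ops ∧
      M'ᶜ.card + τ.num nChanged ≤ Mᶜ.card ∧
      (τ.num nChanged = 0 → ∀ a ∈ A, ∀ b ∈ M', (a, b) ∈ F → a ∈ M') := by
  refine runs_forRange_equiv (pairIdx idx) (N := {nChanged} ∪ arrayAddrs aMarked) (W := ∅)
    writesTo_markFst (by simp) (fun τ hF => by simp [hF.num, hn])
    (fun D τ => ∃ M', Stores τ aMarked idx M' ∧ Saturation P A M₀ M' ∧ τ.ops = σ.ops ∧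
      M'ᶜ.card + τ.num nChanged ≤ Mᶜ.card ∧
      (τ.num nChanged = 0 → ∀ a ∈ A, ∀ b ∈ M', (a, b) ∈ F → (a, b) ∈ D → a ∈ M'))
    ⟨M, by simpa using hM, hsat, rfl, by simp [hchanged], by simp⟩ ?_ ?_
  · rintro D ⟨a, b⟩ - τ hτ hi ⟨M', hM', hsat', hops, hcard, hD⟩
    have hn' : τ.num nVertices = n := by simp [hτ.num, hn]
    refine (runs_markFst hn' hi (hA.of_frame hτ (by simp)) (hF.of_frame hτ (by simp)) hM').mono ?_
    rintro υ ⟨hopsυ, ⟨ha, hb, hab, haM, hMυ, hυ⟩ | ⟨hclosed, hMυ, hυ⟩⟩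
    · refine ⟨insert a M', by simpa using hMυ, hsat'.insert ha hb (hFE hab), hopsυ.trans hops, ?_,
        by simp [hυ]⟩
      have := Finset.card_erase_add_one (Finset.mem_compl.2 haM)
      rw [Finset.compl_insert]
      simp [hυ]
      omega
    · refine ⟨M', by simpa using hMυ, hsat', hopsυ.trans hops, by simpa [hυ] using hcard, ?_⟩
      intro h0 u hu w hw huw hD'
      rcases Finset.mem_insert.1 hD' with heq | hD'
      · obtain ⟨rfl, rfl⟩ := Prod.mk.inj heq
        exact hclosed hu hw huw
      · exact hD (by simpa [hυ] using h0) u hu w hw huw hD'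
  · rintro τ - ⟨M', hM', hsat', hops, hcard, hD⟩
    exact ⟨M', hM', hsat', hops, hcard, by simpa using hD⟩

theorem runs_saturate (hn : σ.num nVertices = n) (hA : Stores σ aDecided idx Aᶜ)
    (hG : StoresGraph P idx A K F σ) (hM : Stores σ aMarked idx M) (hKM : A \ K ⊆ M)
    (hMA : M ⊆ A) :
    Runs choice saturate σ fun τ => ∃ M', Stores τ aMarked idx M' ∧ Saturation P A M M' ∧
      P.IsTrap A (A \ M') ∧ τ.ops = σ.ops := by
  simp only [saturate, runs_block_cons, runs_block_nil, runs_assign, eval_ofNat]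
  refine runs_loop
    (fun τ => Frame saturateNums ∅ σ τ ∧ ∃ M', Stores τ aMarked idx M' ∧ Saturation P A M M' ∧
      τ.ops = σ.ops ∧ (τ.num nChanged = 0 → ∀ a ∈ A, ∀ b ∈ M', (a, b) ∈ F → a ∈ M'))
    (fun τ => (Finset.univ.filter fun v => τ.num (cellAddr aMarked (idx v)) = 0).card +
      τ.num nChanged)
    ⟨(Frame.refl _ _ σ).setNum (by simp [saturateNums]), M, by simpa using hM, .start P hMA, rfl,
      by simp⟩ ?_ ?_
  · rintro τ ⟨hτ, M', hM', hsat, hops, -⟩ hc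
    simp only [runs_block_cons, runs_block_nil, runs_assign, eval_ofNat]
    have hτ' : Frame saturateNums ∅ σ (τ.setNum nChanged 0) := hτ.setNum (by simp [saturateNums])
    refine (runs_saturateRound (by simp [hτ.num, saturateNums, hn])
      (hA.of_frame hτ' (by simp [saturateNums])) (hG.edges.of_frame hτ' (by simp [saturateNums]))
      hG.graph.subset (by simpa using hM') hsat (by simp)).mono_frame (W := ∅)
      writesTo_saturateRound ?_
    rintro υ hυ ⟨M₂, hM₂, hsat₂, hops₂, hcard, hclosed⟩
    refine ⟨⟨hτ'.trans hυ, M₂, hM₂, hsat₂, hops₂.trans hops, hclosed⟩, ?_⟩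
    rw [hM₂.filter_eq_compl, hM'.filter_eq_compl]
    exact hcard.trans_lt (Nat.lt_add_of_pos_right (Nat.pos_of_ne_zero hc))
  · rintro τ ⟨-, M', hM', hsat, hops, hclosed⟩ hc
    exact ⟨M', hM', hsat, hG.graph.isTrap_sdiff (hKM.trans hsat.start_subset) (hclosed hc), hops⟩

end Saturate

section SearchKnown

variable {P : MDP V} {A K M M' : Finset V} {F : Finset (V × V)} {n L h : ℕ} {idx : V ≃ Fin n}
  {σ : State V}

/-- A stage of the search for a root in the subgraph induced by `A`. First, the vertices that reach
an unknown vertex, one in `A \ K`, are added to `M`; then, for one vertex after the other that is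
not in `M`, the vertices that reach it. The vertex treated last is `r`; it is a root as soon as
`M` contains `A`. -/
structure RootSearch (P : MDP V) (A K M : Finset V) (r : Option V) : Prop where
  subset : M ⊆ A
  unknown_subset : A \ K ⊆ M
  isTrap : P.IsTrap A (A \ M)
  reach_of_none : r = none → ∀ v ∈ M, ∃ u ∈ A \ K, P.Reach A v u
  exists_isTrap : ∀ v ∈ r, ∃ T ⊆ A, P.IsTrap A T ∧ v ∈ T ∧ ∀ u ∈ T ∩ M, P.Reach A u v

namespace RootSearch

variable {r : Option V} {v : V}

theorem start (hM : Saturation P A (A \ K) M) (hT : P.IsTrap A (A \ M)) :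
    RootSearch P A K M none :=
  ⟨hM.subset, hM.start_subset, hT, fun _ => hM.reach, by simp⟩

theorem next (h : RootSearch P A K M r) (hv : v ∈ A \ M) (hM : Saturation P A (insert v M) M')
    (hT : P.IsTrap A (A \ M')) : RootSearch P A K M' (some v) where
  subset := hM.subset
  unknown_subset := h.unknown_subset.trans ((Finset.subset_insert v M).trans hM.start_subset)
  isTrap := hT
  reach_of_none := by simp
  exists_isTrap := by
    simp only [Option.mem_some_iff, forall_eq']
    refine ⟨A \ M, Finset.sdiff_subset, h.isTrap, hv, fun u hu => ?_⟩
    obtain ⟨huT, huM⟩ := Finset.mem_inter.1 hu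
    obtain ⟨w, hw, huw⟩ := hM.reach u huM
    rcases Finset.mem_insert.1 hw with rfl | hwM
    · exact huw
    · exact absurd hwM (Finset.mem_sdiff.1 (h.isTrap.mem_of_reach huT huw)).2

theorem isRoot (h : RootSearch P A K M (some v)) (hAM : A ⊆ M) : P.IsRoot A v := by
  obtain ⟨T, hTA, hT, hvT, hreach⟩ := h.exists_isTrap v rfl
  exact hT.isRoot (hTA hvT) hvT fun u hu => hreach u (Finset.mem_inter.2 ⟨hu, hAM (hTA hu)⟩)

end RootSearch

/-- The undecided vertices that are not known are marked. -/
def markUnknown : Stmt :=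
  forRange nIndex (reg nVertices) (.assign (cell aMarked (reg nIndex))
    ((1 - reg (cell aDecided (reg nIndex))) * (1 - reg (cell aKnown (reg nIndex)))))

theorem runs_markUnknown (hn : σ.num nVertices = n) (hA : Stores σ aDecided idx Aᶜ)
    (hK : Stores σ aKnown idx K) :
    Runs choice markUnknown σ fun τ => Stores τ aMarked idx (A \ K) ∧ τ.ops = σ.ops := by
  refine runs_forRange_equiv idx (N := arrayAddrs aMarked) (W := ∅) (by simp [Stmt.WritesTo])
    (by simp) (fun τ hF => by simp [hF.num, hn])
    (fun D τ => (∀ v ∈ D, τ.num (cellAddr aMarked (idx v)) = if v ∈ A \ K then 1 else 0) ∧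
      τ.ops = σ.ops) (by simp) ?_ ?_
  · rintro D v hv τ hF hi ⟨hD, hops⟩
    have hvalue : (1 - τ.num (cellAddr aDecided (idx v))) * (1 - τ.num (cellAddr aKnown (idx v))) =
        if v ∈ A \ K then 1 else 0 := by
      have hvA := hA.of_frame hF (by simp) v
      have hvK := hK.of_frame hF (by simp) v
      by_cases h : v ∈ A <;> by_cases h' : v ∈ K <;> simp_all
    simp only [runs_assign, eval_cell, eval_reg, eval_mul, eval_sub, eval_ofNat, hi, hvalue]
    simp only [Finset.mem_insert, forall_eq_or_imp]
    refine ⟨⟨by simp, fun w hw => ?_⟩, hops⟩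
    have hne : idx w ≠ idx v := fun h => hv (idx.injective h ▸ hw)
    simpa [Function.update_apply, Fin.val_inj, hne] using hD w hw
  · rintro τ - ⟨hD, hops⟩
    exact ⟨fun v => by simp [hD v (Finset.mem_univ v)], hops⟩

@[simp] theorem writesTo_markUnknown {W : Set ℕ} : markUnknown.WritesTo saturateNums W := by
  simp [markUnknown, Stmt.WritesTo, saturateNums]

/-- The number in `nRoot` is `0` for no root and `idx r + 1` for the root `r`. -/
def rootNum {V : Type*} (idx : V ≃ Fin n) : Option V → ℕ
  | none => 0
  | some r => idx r + 1

def tryRoot : Stmt :=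
  .ite ((1 - reg (cell aDecided (reg nRow))) * (1 - reg (cell aMarked (reg nRow))))
    (block [.assign nRoot (reg nRow + 1), .assign (cell aMarked (reg nRow)) 1, saturate]) .skip

theorem runs_tryRoot {r : Option V} {v : V} (hn : σ.num nVertices = n)
    (hA : Stores σ aDecided idx Aᶜ) (hG : StoresGraph P idx A K F σ) (hM : Stores σ aMarked idx M)
    (hS : RootSearch P A K M r) (hroot : σ.num nRoot = rootNum idx r) (hv : σ.num nRow = idx v) :
    Runs choice tryRoot σ fun τ => ∃ M' r', Stores τ aMarked idx M' ∧ RootSearch P A K M' r' ∧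
      τ.num nRoot = rootNum idx r' ∧ M ⊆ M' ∧ (v ∈ A → v ∈ M') ∧ τ.ops = σ.ops := by
  have hcond : (1 - σ.num (cellAddr aDecided (idx v))) * (1 - σ.num (cellAddr aMarked (idx v))) ≠ 0
      ↔ v ∈ A \ M := by
    simp only [ne_eq, mul_eq_zero, not_or, Nat.sub_eq_zero_iff_le, not_le, Nat.lt_one_iff,
      hA.num_eq_zero_iff, hM.num_eq_zero_iff, Finset.mem_compl, not_not, Finset.mem_sdiff]
  simp only [tryRoot, runs_ite, eval_mul, eval_sub, eval_reg, eval_cell, eval_ofNat, hv, hcond,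
    runs_block_cons, runs_block_nil, runs_assign, eval_add]
  split_ifs with hvAM
  · have hvA := (Finset.mem_sdiff.1 hvAM).1
    have hmark : Stores ((σ.setNum nRoot (idx v + 1)).setNum (cellAddr aMarked (idx v)) 1) aMarked
        idx (insert v M) := Stores.insert (by simpa using hM) v
    have hrow : (σ.setNum nRoot (idx v + 1)).num nRow = idx v := by simp [hv]
    rw [hrow]
    refine (runs_saturate (A := A) (K := K) (F := F) (by simp [hn]) (by simpa using hA)
      ⟨by simpa using hG.known, by simpa using hG.edges, hG.graph⟩ hmark
      (hS.unknown_subset.trans (Finset.subset_insert v M))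
      (Finset.insert_subset hvA hS.subset)).mono_frame (W := ∅) writesTo_saturate ?_
    rintro τ hF ⟨M', hM', hsat, htrap, hops⟩
    refine ⟨M', some v, hM', hS.next hvAM hsat htrap, ?_,
      (Finset.subset_insert v M).trans hsat.start_subset,
      fun _ => hsat.start_subset (Finset.mem_insert_self v M), hops⟩
    simp [hF.num, saturateNums, rootNum]
  · exact runs_skip.2 ⟨M, r, hM, hS, hroot, subset_rfl,
      fun hvA => by_contra fun hvM => hvAM (Finset.mem_sdiff.2 ⟨hvA, hvM⟩), rfl⟩

/-- The undecided vertices that reach an unknown one are marked. -/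
def startSearch : Stmt := block [.assign nRoot 0, markUnknown, saturate]

theorem runs_startSearch (hn : σ.num nVertices = n) (hA : Stores σ aDecided idx Aᶜ)
    (hG : StoresGraph P idx A K F σ) :
    Runs choice startSearch σ fun τ => ∃ M, Stores τ aMarked idx M ∧ RootSearch P A K M none ∧
      τ.num nRoot = rootNum idx none ∧ τ.ops = σ.ops := by
  simp only [startSearch, runs_block_cons, runs_block_nil, runs_assign]
  refine (runs_markUnknown (idx := idx) (A := A) (K := K) (by simp [hn]) (by simpa using hA)
    (by simpa using hG.known)).mono_frame (W := ∅) writesTo_markUnknown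
    fun τ hF ⟨hM, hops⟩ => ?_
  have hτ : Frame (insert nRoot saturateNums) ∅ σ τ :=
    (Frame.refl _ _ σ).setNum.trans (hF.mono (Set.subset_insert _ _) subset_rfl)
  refine (runs_saturate (by simp [hτ.num, saturateNums, hn])
    (hA.of_frame hτ (by simp [saturateNums])) (hG.of_frame hτ (by simp [saturateNums])) hM
    subset_rfl Finset.sdiff_subset).mono_frame (W := ∅) writesTo_saturate ?_
  rintro υ hυ ⟨M, hM, hsat, htrap, hopsυ⟩
  exact ⟨M, hM, .start hsat htrap, by simp [hυ.num, hF.num, saturateNums, rootNum],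
    hopsυ.trans hops⟩

/-- The search for a root without symbolic operations. It fails if every undecided vertex reaches
an unknown one. -/
def searchKnown : Stmt := block [
  startSearch,
  forRange nRow (reg nVertices) tryRoot]

/-- The numeric registers written by `searchKnown`. -/
def searchKnownNums : Set ℕ := {nRow, nRoot} ∪ saturateNums

theorem writesTo_saturate_insert {W : Set ℕ} : saturate.WritesTo (insert nRoot saturateNums) W :=
  writesTo_saturate.mono (Set.subset_insert _ _) subset_rfl

@[simp] theorem writesTo_tryRoot {W : Set ℕ} : tryRoot.WritesTo (insert nRoot saturateNums) W := by
  simp only [tryRoot, block, Stmt.WritesTo, writesTo_saturate_insert]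
  simp [saturateNums]

@[simp] theorem writesTo_startSearch {W : Set ℕ} :
    startSearch.WritesTo (insert nRoot saturateNums) W := by
  simp only [startSearch, block, Stmt.WritesTo, writesTo_saturate_insert,
    writesTo_markUnknown.mono (Set.subset_insert nRoot saturateNums) subset_rfl]
  simp

@[simp] theorem writesTo_searchKnown {W : Set ℕ} : searchKnown.WritesTo searchKnownNums W := by
  have hsub : insert nRoot saturateNums ⊆ searchKnownNums := by
    simp [searchKnownNums, Set.insert_union]
  simp only [searchKnown, block, Stmt.WritesTo, writesTo_forRange,
    writesTo_startSearch.mono hsub subset_rfl, writesTo_tryRoot.mono hsub subset_rfl]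
  simp [searchKnownNums]

theorem runs_searchKnown (hn : σ.num nVertices = n) (hA : Stores σ aDecided idx Aᶜ)
    (hG : StoresGraph P idx A K F σ) :
    Runs choice searchKnown σ fun τ => τ.ops = σ.ops ∧
      ((τ.num nRoot = 0 ∧ ∀ v ∈ A, ∃ u ∈ A \ K, P.Reach A v u) ∨
        ∃ r, τ.num nRoot = idx r + 1 ∧ P.IsRoot A r) := by
  simp only [searchKnown, runs_block_cons, runs_block_nil]
  refine (runs_startSearch hn hA hG).mono_frame (W := ∅) writesTo_startSearch ?_
  rintro σ₀ hσ₀ ⟨M₀, hM₀, hS₀, hroot₀, hops₀⟩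
  have frame {τ : State V} (hτ : Frame (insert nRow (insert nRoot saturateNums)) ∅ σ₀ τ) :
      Frame (insert nRow (insert nRoot saturateNums)) ∅ σ τ :=
    (hσ₀.mono (Set.subset_insert _ _) subset_rfl).trans hτ
  refine runs_forRange_equiv idx (N := insert nRoot saturateNums) (W := ∅) writesTo_tryRoot
    (by simp [saturateNums]) (fun τ hτ => by simp [(frame hτ).num, saturateNums, hn])
    (fun D τ => ∃ M r, Stores τ aMarked idx M ∧ RootSearch P A K M r ∧
      τ.num nRoot = rootNum idx r ∧ D ∩ A ⊆ M ∧ τ.ops = σ.ops)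
    ⟨M₀, none, by simpa using hM₀, hS₀, by simpa using hroot₀, by simp, hops₀⟩ ?_ ?_
  · rintro D v hv τ hτ hrow ⟨M, r, hM, hS, hroot, hD, hops⟩
    have hF := frame hτ
    refine (runs_tryRoot (by simp [hF.num, saturateNums, hn])
      (hA.of_frame hF (by simp [saturateNums])) (hG.of_frame hF (by simp [saturateNums])) hM hS
      hroot hrow).mono ?_
    rintro υ ⟨M', r', hM', hS', hroot', hMM', hvM', hopsυ⟩
    refine ⟨M', r', by simpa using hM', hS', by simpa using hroot', fun u hu => ?_,
      hopsυ.trans hops⟩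
    obtain ⟨huD, huA⟩ := Finset.mem_inter.1 hu
    rcases Finset.mem_insert.1 huD with rfl | huD
    · exact hvM' huA
    · exact hMM' (hD (Finset.mem_inter.2 ⟨huD, huA⟩))
  · rintro τ - ⟨M, r, -, hS, hroot, hD, hops⟩
    have hAM : A ⊆ M := by simpa using hD
    refine ⟨hops, ?_⟩
    cases r with
    | none => exact .inl ⟨hroot, fun v hv => hS.reach_of_none rfl v (hAM hv)⟩
    | some r => exact .inr ⟨r, hroot, hS.isRoot hAM⟩

end SearchKnown

/-! ## One iteration -/

section Iteration

variable {P : MDP V} {A K : Finset V} {F : Finset (V × V)} {n L h : ℕ} {idx : V ≃ Fin n}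
  {σ : State V}

/-- The invariant of the main loop. The vertices in `A` are undecided, those in `K` are known. As
`nRefreshed` holds the number of the undecided vertices at the last refresh, an unknown vertex has
more than `h` undecided successors until a further `h` vertices have been decided. -/
structure Stage (P : MDP V) (idx : V ≃ Fin n) (L h : ℕ) (A K : Finset V) (F : Finset (V × V))
    (σ : State V) : Prop where
  env : Env P idx L h σ
  undecided : σ.vert vUndecided = A
  card : σ.num nUndecided = A.card
  decided : Stores σ aDecided idx Aᶜ
  decomposition : P.PartialDecomposition A ∅ (σ.vert vRest) σ.out
  graph : StoresGraph P idx A K F σ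
  degree : ∀ v ∈ A \ K, 2 * h + A.card < (post P.edges {v} ∩ A).card + σ.num nRefreshed

/-- The potential of the amortized analysis: `h` times the number of the operations so far, and
what is saved for refreshes, for deciding vertices and for learning rows. -/
def potential (n L h : ℕ) (A K : Finset V) (σ : State V) : ℕ :=
  h * σ.ops + (L + 9) * n * σ.num nRefreshed + (8 * n + h * (2 * L + 27)) * A.card +
    h * ((L + 3) * (2 * h) * (A \ K).card)

theorem card_le_of_equiv_fin {V : Type*} (idx : V ≃ Fin n) (A : Finset V) :
    A.card ≤ n := by
  simpa using Finset.card_le_card_of_injOn idx (fun _ _ => Finset.mem_univ _) idx.injective.injOn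

/-- The known part of the graph is updated when more than `h` vertices have been decided since the
last refresh. -/
def refreshIfDue : Stmt :=
  .ite (reg nRefreshed - (reg nUndecided + reg nThreshold))
    (block [refresh, .assign nRefreshed (reg nUndecided)]) .skip

theorem runs_refreshIfDue (hch : ∀ t X, X.Nonempty → choice t X ∈ X) (hA : A.Nonempty)
    (hS : Stage P idx L h A K F σ) :
    Runs choice refreshIfDue σ fun τ => ∃ K' F', Stage P idx L h A K' F' τ ∧
      τ.num nRefreshed ≤ A.card + h ∧ potential n L h A K' τ ≤ potential n L h A K σ := by
  simp only [refreshIfDue, runs_ite, eval_sub, eval_add, eval_reg, eval_ofNat, hS.card,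
    hS.env.threshold]
  split_ifs with hdue
  swap
  · exact runs_skip.2 ⟨K, F, hS, by omega, le_rfl⟩
  simp only [runs_block_cons, runs_block_nil, runs_assign]
  refine (runs_refresh hch hS.env hS.undecided hS.graph).mono_frame (N := refreshNums)
    (W := {vWorklist, vPicked, vSuccessors}) (by simp) ?_
  rintro τ hF ⟨K', F', hG, hlarge, hops⟩
  have hcard : τ.num nUndecided = A.card := by simp [hF.num, refreshNums, hS.card]
  have hF' : Frame (insert nRefreshed refreshNums) {vWorklist, vPicked, vSuccessors} σ
      (τ.setNum nRefreshed A.card) :=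
    (hF.mono (Set.subset_insert _ _) subset_rfl).setNum
  simp only [eval_reg, eval_ofNat, hcard]
  refine ⟨K', F', ?_, by simp, ?_⟩
  · exact {
      env := hS.env.of_frame hF' (by simp [refreshNums, or_imp, forall_and]) (by simp)
      undecided := by simp [hF.vert, hS.undecided]
      card := by simpa using hcard
      decided := by simpa using hS.decided.of_frame hF (by simp [refreshNums])
      decomposition := by simpa [hF.vert, hF.out] using hS.decomposition
      graph := ⟨by simpa using hG.known, by simpa using hG.edges, hG.graph⟩
      degree := fun v hv => by simpa using hlarge v hv }
  · have hpos := hA.card_pos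
    have hle := card_le_of_equiv_fin idx A
    have hcost : 2 + (L + 7) * A.card ≤ (L + 9) * n := by nlinarith
    have hsaved : A.card + h ≤ σ.num nRefreshed := by omega
    simp only [potential, State.setNum_ops, State.setNum_num, Function.update_self]
    nlinarith [Nat.mul_le_mul_left h hops, Nat.mul_le_mul_left h hcost,
      Nat.mul_le_mul_left ((L + 9) * n) hsaved]

/-- The numeric registers that may change within a stage. -/
def scratchNums : Set ℕ := Set.Ico 6 16 ∪ arrayAddrs aMarked

/-- The vertex registers that may change within a stage. -/
def scratchVerts : Set ℕ := {vPicked, vWorklist, vSuccessors, vComponent, vFrontier, vRemoved}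

theorem Stage.of_frame {τ : State V} (hS : Stage P idx L h A K F σ)
    (hF : Frame scratchNums scratchVerts σ τ) : Stage P idx L h A K F τ where
  env := hS.env.of_frame hF (by
    simp only [scratchNums, Set.mem_union, Set.mem_Ico, or_imp, forall_and, forall_mem_arrayAddrs]
    exact ⟨fun a ha => by omega, by simp⟩) (by simp [scratchVerts])
  undecided := by simp [hF.vert, scratchVerts, hS.undecided]
  card := by simp [hF.num, scratchNums, hS.card]
  decided := hS.decided.of_frame hF (by simp [scratchNums])
  decomposition := by simpa [hF.vert, scratchVerts, hF.out] using hS.decomposition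
  graph := hS.graph.of_frame hF (by simp [scratchNums])
  degree := by simpa [hF.num, scratchNums] using hS.degree

def findRoot : Stmt := block [searchKnown, .ite (reg nRoot) select searchRoot]

theorem writesTo_findRoot : findRoot.WritesTo scratchNums scratchVerts := by
  have hsearch := writesTo_searchKnown.mono (N' := scratchNums) (W' := scratchVerts)
    (by simp [searchKnownNums, saturateNums, scratchNums, Set.insert_subset_iff])
    (Set.empty_subset _)
  have hroot : select.WritesTo scratchNums scratchVerts ∧
      searchRoot.WritesTo scratchNums scratchVerts := by
    simp [select, searchRoot, visitBackward, block, Stmt.WritesTo, Instr.WritesTo, scratchNums,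
      scratchVerts]
  exact ⟨hsearch, hroot, trivial⟩

/-- A root that reaches an unknown vertex also reaches the more than `h` undecided successors of
that vertex. -/
theorem Stage.lt_card_reachSet (hS : Stage P idx L h A K F σ)
    (hdue : σ.num nRefreshed ≤ A.card + h) {r u : V} (hr : r ∈ A) (hu : u ∈ A \ K)
    (hru : P.Reach A r u) : h < (P.reachSet A r).card := by
  have hsub : post P.edges {u} ∩ A ⊆ P.reachSet A r := fun w hw => by
    obtain ⟨huw, hwA⟩ := Finset.mem_inter.1 hw
    exact MDP.isTrap_reachSet hr u (MDP.mem_reachSet.2 hru) w hwA (by simpa [mem_post] using huw)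
  have := Finset.card_le_card hsub
  have := hS.degree u hu
  omega

theorem runs_findRoot (hch : ∀ t X, X.Nonempty → choice t X ∈ X) (hA : A.Nonempty)
    (hS : Stage P idx L h A K F σ) (hdue : σ.num nRefreshed ≤ A.card + h) :
    Runs choice findRoot σ fun τ => ∃ r, τ.vert vPicked = {r} ∧ P.IsRoot A r ∧
      h * τ.ops ≤ h * (σ.ops + L + 2) + 8 * n * (P.reachSet A r).card := by
  simp only [findRoot, runs_block_cons, runs_block_nil]
  refine (runs_searchKnown hS.env.vertices hS.decided hS.graph).mono_frame (W := ∅)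
    writesTo_searchKnown ?_
  rintro τ hF ⟨hops, hroot⟩
  have hS' : Stage P idx L h A K F τ := hS.of_frame (hF.mono (by
    simp [searchKnownNums, saturateNums, scratchNums, Set.insert_subset_iff]) (by simp))
  rw [runs_ite, eval_reg, eval_ofNat]
  rcases hroot with ⟨h0, hreach⟩ | ⟨r, hr, hroot⟩
  · rw [if_neg (by simpa using h0)]
    refine (runs_searchRoot hch hS'.env.edges hS'.undecided hA).mono ?_
    rintro υ ⟨⟨r, hp, hroot⟩, hopsυ⟩
    obtain ⟨u, hu, hru⟩ := hreach r hroot.1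
    refine ⟨r, hp, hroot, ?_⟩
    have hlt := hS.lt_card_reachSet hdue hroot.1 hu hru
    have hle : h * A.card ≤ n * (P.reachSet A r).card := by
      rw [mul_comm]
      exact Nat.mul_le_mul (card_le_of_equiv_fin idx A) hlt.le
    nlinarith [Nat.mul_le_mul_left h hopsυ]
  · rw [if_pos (by omega)]
    refine (runs_select hS'.env.bits hS'.env.all hr).mono ?_
    rintro υ ⟨hp, hopsυ⟩
    refine ⟨r, hp, hroot, ?_⟩
    rw [hopsυ, hS'.env.numBits, hops]
    nlinarith

/-- The component in `vComponent` and its random attractor are decided. -/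
def decideComponent : Stmt := block [
  removeComponent,
  storeEach vRemoved aDecided (reg nNumber),
  .sym (.card nUndecided vUndecided)]

/-- The numeric registers written by `decideComponent`. -/
def decideNums : Set ℕ := insert nUndecided (storeEachNums aDecided)

/-- The vertex registers written by `decideComponent`. -/
def decideVerts : Set ℕ := {vUndecided, vPicked, vFrontier, vRest, vRemoved}

theorem writesTo_removeComponent :
    removeComponent.WritesTo {nCard} {vUndecided, vFrontier, vRest, vRemoved} := by
  simp [removeComponent, block, Stmt.WritesTo, Instr.WritesTo]

@[simp] theorem writesTo_decideComponent : decideComponent.WritesTo decideNums decideVerts := by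
  have hremove := writesTo_removeComponent.mono (N' := decideNums) (W' := decideVerts)
    (by simp [decideNums, storeEachNums]) (by simp [decideVerts, Set.insert_subset_iff])
  have hstore := (writesTo_storeEach (X := vRemoved) (k := aDecided) (e := reg nNumber)).mono
    (N' := decideNums) (W' := decideVerts) (Set.subset_insert _ _)
    (by simp [decideVerts, Set.insert_subset_iff])
  have hmem : nUndecided ∈ decideNums := Set.mem_insert _ _
  simp [decideComponent, block, Stmt.WritesTo, hremove, hstore, hmem, Instr.WritesTo]

theorem runs_decideComponent {C : Finset V} {out : List (Finset V)}
    (hch : ∀ t X, X.Nonempty → choice t X ∈ X) (hS : Stage P idx L h A K F σ)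
    (hC : σ.vert vComponent = C) (hne : C.Nonempty) (hCA : C ⊆ A)
    (hdec : P.PartialDecomposition (A \ C) C (σ.vert vRest) out) :
    Runs choice decideComponent σ fun τ => ∃ A' ⊂ A, τ.vert vUndecided = A' ∧
      τ.num nUndecided = A'.card ∧ Stores τ aDecided idx A'ᶜ ∧
      P.PartialDecomposition A' ∅ (τ.vert vRest) out ∧
      τ.ops + (L + 9) * A'.card ≤ σ.ops + 7 + (L + 9) * A.card := by
  simp only [decideComponent, runs_block_cons, runs_block_nil, runs_sym]
  refine (runs_removeComponent hS.env.edges hS.env.random hS.undecided hC hne hCA hdec).mono_frame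
    writesTo_removeComponent ?_
  rintro τ hF ⟨hdecτ, hlt, hremoved, hops⟩
  refine (runs_storeEach (g := id) hch (hS.env.of_frame hF (by simp) (by simp)) (by simp)
    (by simp) (fun υ v _ hv => by simpa using hv) (hS.decided.of_frame hF (by simp))).mono_frame
    writesTo_storeEach ?_
  rintro υ hFυ ⟨hdecided, hopsυ⟩
  have hundecided : υ.vert vUndecided = τ.vert vUndecided := by simp [hFυ.vert]
  have hcompl : Aᶜ ∪ A \ τ.vert vUndecided = (τ.vert vUndecided)ᶜ := by
    ext v
    have hv : v ∈ τ.vert vUndecided → v ∈ A := fun h => hlt.subset h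
    simp only [Finset.mem_union, Finset.mem_compl, Finset.mem_sdiff]
    tauto
  have hcard := Finset.card_sdiff_add_card_eq_card hlt.subset
  rw [hremoved] at hdecided hopsυ
  rw [Finset.image_id, hcompl] at hdecided
  refine ⟨τ.vert vUndecided, hlt, by simpa using hundecided, by simp [hundecided],
    by simpa using hdecided, by simpa [hFυ.vert] using hdecτ, ?_⟩
  simp only [Instr.effect, State.tick_ops, State.setNum_ops, hopsυ]
  nlinarith

theorem card_inter_add_card_le {V : Type*} [DecidableEq V] {A B : Finset V} (X : Finset V)
    (hBA : B ⊆ A) : (X ∩ A).card + B.card ≤ (X ∩ B).card + A.card := by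
  have hsub : X ∩ A ⊆ X ∩ B ∪ A \ B := fun v hv => by
    simp only [Finset.mem_inter, Finset.mem_union, Finset.mem_sdiff] at hv ⊢
    tauto
  have hle := (Finset.card_le_card hsub).trans (Finset.card_union_le _ _)
  have := Finset.card_sdiff_add_card_eq_card hBA
  omega

theorem Env.emit (henv : Env P idx L h σ) {X : ℕ} :
    Env P idx L h ((Instr.emit X).effect choice σ).tick :=
  ⟨henv.edges, henv.all, henv.random, henv.vertices, henv.numBits, henv.threshold,
    ⟨henv.bits.le_two_pow, henv.bits.mem_iff⟩, henv.vertRegs_le, henv.edgeRegs⟩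

/-- The component of the vertex picked last, a root, is decided and put out. -/
def outputComponent : Stmt := block [component, decideComponent, .sym (.emit vComponent)]

theorem runs_outputComponent {r : V} (hch : ∀ t X, X.Nonempty → choice t X ∈ X)
    (hS : Stage P idx L h A K F σ) (hp : σ.vert vPicked = {r}) (hr : P.IsRoot A r) :
    Runs choice outputComponent σ fun τ => ∃ A' ⊂ A, Stage P idx L h A' K F τ ∧
      A'.card + (P.reachSet A r).card ≤ A.card ∧ τ.num nRefreshed = σ.num nRefreshed ∧
      τ.ops + (L + 9) * A'.card ≤
        σ.ops + 11 + 5 * (P.reachSet A r).card + (L + 9) * A.card := by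
  simp only [outputComponent, runs_block_cons, runs_block_nil, runs_sym]
  refine (runs_component hS.env.edges hS.undecided hp hr.1).mono_frame (N := {nCard})
    (W := {vComponent, vFrontier})
    (by simp [component, block, Stmt.WritesTo, Instr.WritesTo]) ?_
  rintro τ hF ⟨hC, hops⟩
  have hS' : Stage P idx L h A K F τ := hS.of_frame (hF.mono
    (by simp [scratchNums]) (by simp [scratchVerts, Set.insert_subset_iff]))
  have hCA := MDP.reachSet_subset (P := P) hr.1
  refine (runs_decideComponent hch hS' hC ⟨r, MDP.self_mem_reachSet⟩ hCA
    (hS'.decomposition.removeComponent hr)).mono_frame writesTo_decideComponent ?_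
  rintro υ hFυ ⟨A', hlt, hundecided, hcard, hdecided, hdec, hopsυ⟩
  have hcomponent : υ.vert vComponent = P.reachSet A r := by simp [hFυ.vert, decideVerts, hC]
  have henv : Env P idx L h υ := hS'.env.of_frame hFυ (by
    simp [decideNums, storeEachNums, or_imp, forall_and]) (by simp [decideVerts])
  have hgraph := hS'.graph.of_frame hFυ (by simp [decideNums, storeEachNums])
  have hrefreshed : υ.num nRefreshed = τ.num nRefreshed := by
    simp [hFυ.num, decideNums, storeEachNums]
  have hdisj : Disjoint (P.reachSet A r) A' := hdec.disjoint _ (by simp)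
  have hle : A'.card + (P.reachSet A r).card ≤ A.card := by
    rw [add_comm, ← Finset.card_union_of_disjoint hdisj]
    exact Finset.card_le_card (Finset.union_subset hCA hlt.subset)
  refine ⟨A', hlt, ?_, hle, ?_, ?_⟩
  · exact {
      env := henv.emit
      undecided := hundecided
      card := hcard
      decided := hdecided
      decomposition := by simpa [Instr.effect, hFυ.out, hcomponent] using hdec
      graph := ⟨hgraph.known, hgraph.edges, hgraph.graph.anti hlt.subset⟩
      degree := fun v hv => by
        have := hS'.degree v (Finset.sdiff_subset_sdiff hlt.subset subset_rfl hv)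
        have := card_inter_add_card_le (post P.edges {v}) hlt.subset
        change 2 * h + A'.card < _ + υ.num nRefreshed
        omega }
  · exact hrefreshed.trans (by simp [hF.num])
  · simp only [Instr.effect, State.tick_ops]
    omega

def iteration : Stmt := block [refreshIfDue, findRoot, outputComponent]

theorem runs_iteration (hch : ∀ t X, X.Nonempty → choice t X ∈ X) (hA : A.Nonempty)
    (hS : Stage P idx L h A K F σ) :
    Runs choice iteration σ fun τ => ∃ A' ⊂ A, ∃ K' F', Stage P idx L h A' K' F' τ ∧
      potential n L h A' K' τ ≤ potential n L h A K σ := by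
  simp only [iteration, runs_block_cons, runs_block_nil]
  refine (runs_refreshIfDue hch hA hS).mono ?_
  rintro τ ⟨K', F', hS', hdue, hle⟩
  refine (runs_findRoot hch hA hS' hdue).mono_frame writesTo_findRoot ?_
  rintro υ hF ⟨r, hp, hr, hops⟩
  refine (runs_outputComponent hch (hS'.of_frame hF) hp hr).mono ?_
  rintro φ ⟨A', hlt, hSφ, hcard, hrefreshed, hopsφ⟩
  refine ⟨A', hlt, K', F', hSφ, le_trans ?_ hle⟩
  have hnum : υ.num nRefreshed = τ.num nRefreshed := by simp [hF.num, scratchNums]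
  have hpos : 0 < (P.reachSet A r).card := Finset.card_pos.2 ⟨r, MDP.self_mem_reachSet⟩
  have hsdiff : (A' \ K').card ≤ (A \ K').card :=
    Finset.card_le_card (Finset.sdiff_subset_sdiff hlt.subset subset_rfl)
  obtain ⟨δ, hδ⟩ := Nat.exists_eq_add_of_le (Finset.card_le_card hlt.subset)
  have hCδ : (P.reachSet A r).card ≤ δ := by omega
  have hcost : φ.ops + L + 2 ≤ υ.ops + (2 * L + 27) * δ := by
    rw [hδ] at hopsφ
    nlinarith
  simp only [potential, hrefreshed, hnum, hδ]
  nlinarith [Nat.mul_le_mul_left h hcost, Nat.mul_le_mul_left (8 * n) hCδ,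
    Nat.mul_le_mul_left (h * ((L + 3) * (2 * h))) hsdiff]

end Iteration

/-! ## Setting up the memory -/

section Setup

variable {P : MDP V} {n L k : ℕ} {σ : State V}

/-- The number of bits is found by doubling. -/
def computeBits : Stmt := block [
  .assign nBits 0,
  .assign nPower 1,
  .loop (reg nVertices - reg nPower) (block [
    .assign nPower (2 * reg nPower),
    .assign nBits (reg nBits + 1)])]

theorem writesTo_computeBits : computeBits.WritesTo {nBits, nPower} ∅ := by
  simp [computeBits, block, Stmt.WritesTo]

theorem runs_computeBits (hn : σ.num nVertices = n) (hpos : 0 < n) :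
    Runs choice computeBits σ fun τ => τ.ops = σ.ops ∧
      n ≤ 2 ^ τ.num nBits ∧ 2 ^ τ.num nBits ≤ 2 * n := by
  simp only [computeBits, runs_block_cons, runs_block_nil, runs_assign]
  refine runs_loop (fun τ => τ.num nVertices = n ∧ τ.ops = σ.ops ∧
    τ.num nPower = 2 ^ τ.num nBits ∧ 2 ^ τ.num nBits ≤ 2 * n) (fun τ => n - τ.num nPower)
    (by simp [hn]; omega) ?_ ?_
  · rintro τ ⟨hnτ, hops, hpow, -⟩ hc
    simp only [eval_sub, eval_reg, eval_ofNat, hnτ] at hc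
    have := Nat.two_pow_pos (τ.num nBits)
    simp [hnτ, hops, hpow, pow_succ']
    omega
  · rintro τ ⟨hnτ, hops, hpow, hle⟩ hc
    simp only [eval_sub, eval_reg, eval_ofNat, hnτ] at hc
    exact ⟨hops, by omega, hle⟩

/-- The threshold is the square root of the number of the vertices, rounded up. -/
def computeThreshold : Stmt := block [
  .assign nThreshold 0,
  .loop (reg nVertices - reg nThreshold * reg nThreshold)
    (.assign nThreshold (reg nThreshold + 1))]

theorem writesTo_computeThreshold : computeThreshold.WritesTo {nThreshold} ∅ := by
  simp [computeThreshold, block, Stmt.WritesTo]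

theorem runs_computeThreshold (hn : σ.num nVertices = n) :
    Runs choice computeThreshold σ fun τ => τ.ops = σ.ops ∧
      n ≤ τ.num nThreshold * τ.num nThreshold ∧ τ.num nThreshold * τ.num nThreshold ≤ 4 * n := by
  simp only [computeThreshold, runs_block_cons, runs_block_nil, runs_assign]
  refine runs_loop (fun τ => τ.num nVertices = n ∧ τ.ops = σ.ops ∧
    τ.num nThreshold * τ.num nThreshold ≤ 4 * n) (fun τ => n - τ.num nThreshold)
    (by simp [hn]) ?_ ?_
  · rintro τ ⟨hnτ, hops, -⟩ hc
    simp only [eval_sub, eval_mul, eval_reg, eval_ofNat, hnτ] at hc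
    have hlt : τ.num nThreshold * τ.num nThreshold < n := by omega
    have := Nat.le_mul_self (τ.num nThreshold)
    simp only [runs_assign, eval_add, eval_reg, eval_ofNat, State.setNum_num, State.setNum_ops,
      Function.update_self]
    exact ⟨⟨by simp [hnτ], hops, by nlinarith⟩, by omega⟩
  · rintro τ ⟨hnτ, hops, hle⟩ hc
    simp only [eval_sub, eval_mul, eval_reg, eval_ofNat, hnτ] at hc
    exact ⟨hops, by omega, hle⟩

def computeSizes : Stmt := block [.sym (.card nVertices vAll), computeBits, computeThreshold]

theorem writesTo_computeSizes :
    computeSizes.WritesTo {nVertices, nBits, nPower, nThreshold} ∅ := by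
  simp [computeSizes, computeBits, computeThreshold, block, Stmt.WritesTo, Instr.WritesTo]

theorem runs_computeSizes [Nonempty V] (hall : σ.vert vAll = Finset.univ) :
    Runs choice computeSizes σ fun τ => τ.num nVertices = Fintype.card V ∧
      (Fintype.card V ≤ 2 ^ τ.num nBits ∧ 2 ^ τ.num nBits ≤ 2 * Fintype.card V) ∧
      (Fintype.card V ≤ τ.num nThreshold * τ.num nThreshold ∧
        τ.num nThreshold * τ.num nThreshold ≤ 4 * Fintype.card V) ∧ τ.ops = σ.ops + 1 := by
  simp only [computeSizes, runs_block_cons, runs_block_nil, runs_sym]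
  refine (runs_computeBits (n := Fintype.card V) (by simp [Instr.effect, hall])
    Fintype.card_pos).mono_frame writesTo_computeBits ?_
  rintro τ hF ⟨hops, hbits⟩
  have hn : τ.num nVertices = Fintype.card V := by simp [hF.num, Instr.effect, hall]
  refine (runs_computeThreshold hn).mono_frame writesTo_computeThreshold ?_
  rintro υ hF' ⟨hops', hthreshold⟩
  have hbits' : υ.num nBits = τ.num nBits := hF'.num _ (by simp)
  exact ⟨by simp [hF'.num, hn], by rwa [hbits'], hthreshold, by simp [hops', hops, Instr.effect]⟩

/-- The vertex picked last receives the number in `nIndex`. -/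
def storeBits : Stmt := block [
  .assign nNumber (reg nIndex),
  forRange nBit (reg nBits) (block [
    .ite (reg nNumber - 2 * (reg nNumber / 2))
      (.sym (.vertOp .union (vBits + reg nBit) (vBits + reg nBit) vPicked)) .skip,
    .assign nNumber (reg nNumber / 2)])]

theorem writesTo_storeBits :
    storeBits.WritesTo {nNumber, nBit} (Set.Ici vBits) := by
  simp [storeBits, block, Stmt.WritesTo, Instr.WritesTo]

theorem runs_storeBits {v : V} (hp : σ.vert vPicked = {v}) (hL : σ.num nBits = L)
    (hk : σ.num nIndex = k) (hregs : σ.vertRegs ≤ 11 + L) :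
    Runs choice storeBits σ fun τ => τ.vertRegs ≤ 11 + L ∧ τ.ops ≤ σ.ops + L ∧
      ∀ i < L, ∀ w, w ∈ τ.vert (vBits + i) ↔
        w ∈ σ.vert (vBits + i) ∨ w = v ∧ k.testBit i := by
  simp only [storeBits, runs_block_cons, runs_block_nil, runs_assign]
  refine runs_forRange (N := {nNumber}) (W := Set.Ici vBits) (n := L)
    (by simp [block, Stmt.WritesTo, Instr.WritesTo]) (by simp)
    (fun τ hF => by simp [hF.num, hL])
    (fun j τ => τ.num nNumber = k / 2 ^ j ∧ τ.vertRegs ≤ 11 + L ∧ τ.ops ≤ σ.ops + j ∧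
      ∀ i w, w ∈ τ.vert (vBits + i) ↔ w ∈ σ.vert (vBits + i) ∨ i < j ∧ w = v ∧ k.testBit i)
    (by simp [hk, hregs]) ?_ ?_
  · rintro j hj τ hF hτ ⟨hnum, hregsτ, hops, hmem⟩
    have hpτ : τ.vert vPicked = {v} := (hF.vert _ (by simp)).trans hp
    have hdigit : k / 2 ^ j - 2 * (k / 2 ^ j / 2) = (k.testBit j).toNat := by
      rw [Nat.toNat_testBit]
      omega
    have hdiv : k / 2 ^ j / 2 = k / 2 ^ (j + 1) := by rw [Nat.div_div_eq_div_mul, pow_succ]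
    simp only [runs_block_cons, runs_block_nil, runs_ite, runs_skip, runs_assign, runs_sym,
      eval_sub, eval_mul, eval_div, eval_reg, eval_ofNat, hnum, hdigit]
    cases hbit : k.testBit j
    · simp only [Bool.toNat_false, ne_eq, not_true_eq_false, ↓reduceIte, hdiv]
      refine ⟨by simp, by simpa using hregsτ, by simp; omega, fun i w => ?_⟩
      have hiff : i < j ∧ w = v ∧ k.testBit i ↔ i < j + 1 ∧ w = v ∧ k.testBit i := by grind
      simpa [hmem] using or_congr_right hiff
    · simp only [Bool.toNat_true, ne_eq, one_ne_zero, not_false_eq_true, ↓reduceIte]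
      refine ⟨by simp [hnum, hdiv], by simp [hτ, hregsτ, hj], by simp; omega, fun i w => ?_⟩
      rcases eq_or_ne i j with rfl | hij
      · simp [hτ, hpτ, hmem, hbit, or_comm]
      · simp [hτ, hij, hmem, hij.le_iff_lt, Order.lt_add_one_iff]
  · rintro τ - ⟨-, hregsτ, hops, hmem⟩
    exact ⟨hregsτ, hops, fun i hi w => by simp [hmem, hi]⟩

theorem injOn_update_card {α : Type*} [DecidableEq α] {D : Finset α} {f : α → ℕ} {a : α}
    (ha : a ∉ D) (hlt : ∀ b ∈ D, f b < D.card) (hf : Set.InjOn f D) :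
    Set.InjOn (Function.update f a D.card) ↑(insert a D) := by
  rw [Finset.coe_insert, Set.injOn_insert (by simpa using ha)]
  have heq : Set.EqOn f (Function.update f a D.card) D := fun b hb =>
    (Function.update_of_ne (ne_of_mem_of_not_mem hb (by simpa using ha)) _ _).symm
  refine ⟨hf.congr heq, ?_⟩
  rintro ⟨b, hb, hba⟩
  rw [← heq hb, Function.update_self] at hba
  exact (hlt b hb).ne hba

/-- The vertices are numbered in the order in which they are picked. -/
def numberWorklist : Stmt :=
  forEach vWorklist (block [storeBits, .assign nIndex (reg nIndex + 1)])

/-- The vertices in `D` have received the numbers below `D.card`. -/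
structure PartialNumbering (L : ℕ) (D : Finset V) (f : V → ℕ) (σ : State V) : Prop where
  next : σ.num nIndex = D.card
  lt_card : ∀ v ∈ D, f v < D.card
  injOn : Set.InjOn f D
  mem_iff : ∀ i < L, ∀ v, v ∈ σ.vert (vBits + i) ↔ v ∈ D ∧ (f v).testBit i

theorem PartialNumbering.insert {V : Type*} [DecidableEq V] {σ τ : State V} {D : Finset V}
    {f : V → ℕ} {v : V}
    (h : PartialNumbering L D f σ) (hv : v ∉ D) (hnext : τ.num nIndex = D.card + 1)
    (hmem : ∀ i < L, ∀ w, w ∈ τ.vert (vBits + i) ↔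
      w ∈ σ.vert (vBits + i) ∨ w = v ∧ D.card.testBit i) :
    PartialNumbering L (insert v D) (Function.update f v D.card) τ where
  next := by rw [hnext, Finset.card_insert_of_notMem hv]
  lt_card := by
    rw [Finset.card_insert_of_notMem hv, Finset.forall_mem_insert, Function.update_self]
    refine ⟨Nat.lt_succ_self _, fun w hw => ?_⟩
    rw [Function.update_of_ne (ne_of_mem_of_not_mem hw hv)]
    exact (h.lt_card w hw).trans (Nat.lt_succ_self _)
  injOn := injOn_update_card hv h.lt_card h.injOn
  mem_iff i hi w := by
    rw [hmem i hi, h.mem_iff i hi]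
    rcases eq_or_ne w v with rfl | hwv
    · simp [hv]
    · simp [hwv]

theorem PartialNumbering.exists_storesBits {V : Type*} [Fintype V] {σ : State V} {f : V → ℕ}
    (h : PartialNumbering (σ.num nBits) Finset.univ f σ)
    (hle : Fintype.card V ≤ 2 ^ σ.num nBits) :
    ∃ idx : V ≃ Fin (Fintype.card V), StoresBits idx σ := by
  let g (v : V) : Fin (Fintype.card V) := ⟨f v, h.lt_card v (Finset.mem_univ v)⟩
  have hg : Function.Injective g := fun v w hvw => h.injOn (by simp) (by simp) (Fin.ext_iff.1 hvw)
  have hbij := (Fintype.bijective_iff_injective_and_card g).2 ⟨hg, (Fintype.card_fin _).symm⟩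
  exact ⟨.ofBijective g hbij, hle, fun i hi v => by simpa [g] using h.mem_iff i hi v⟩

theorem runs_numberWorklist (hch : ∀ t X, X.Nonempty → choice t X ∈ X)
    (hall : σ.vert vWorklist = Finset.univ) (hindex : σ.num nIndex = 0) (hL : σ.num nBits = L)
    (hle : Fintype.card V ≤ 2 ^ L) (hbits : ∀ i, σ.vert (vBits + i) = ∅)
    (hregs : σ.vertRegs ≤ 11 + L) :
    Runs choice numberWorklist σ fun τ => (∃ idx : V ≃ Fin (Fintype.card V), StoresBits idx τ) ∧
      τ.vertRegs ≤ 11 + L ∧ τ.ops ≤ σ.ops + 1 + (L + 3) * Fintype.card V := by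
  have hbody := writesTo_storeBits.mono (N' := {nCard, nNumber, nBit, nIndex})
    (W' := insert vPicked (Set.Ici vBits)) (by simp [Set.insert_subset_iff])
    (Set.subset_insert _ _)
  refine runs_forEach (N := {nCard, nNumber, nBit, nIndex}) (W := insert vPicked (Set.Ici vBits))
    hch (by simp [block, Stmt.WritesTo, hbody]) (by simp) (by simp) (by simp)
    (fun D τ => (∃ f, PartialNumbering L D f τ) ∧ τ.vertRegs ≤ 11 + L ∧
      τ.ops ≤ σ.ops + (L + 3) * D.card) ?_ ?_ ?_
  · exact ⟨⟨0, by constructor <;> simp [hindex, hbits]⟩, hregs, by simp⟩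
  · rintro D v τ τ' hv hF ⟨⟨f, hf⟩, hregsτ, hops⟩ hF' hp hops'
    have hvD : v ∉ D := (Finset.mem_sdiff.1 hv).2
    have hLτ' : τ'.num nBits = L := by simp [hF'.num, hF.num, hL]
    have hnext : τ'.num nIndex = D.card := by simp [hF'.num, hf.next]
    have hregsτ' : τ'.vertRegs ≤ 11 + L := hF'.vertRegs_le _ (by simp; omega) hregsτ
    have hbitsτ' (i : ℕ) : τ'.vert (vBits + i) = τ.vert (vBits + i) :=
      hF'.vert _ (by simp; omega)
    simp only [runs_block_cons, runs_block_nil, runs_assign]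
    refine (runs_storeBits hp hLτ' hnext hregsτ').mono_frame writesTo_storeBits ?_
    rintro υ hFυ ⟨hregsυ, hopsυ, hmemυ⟩
    refine ⟨⟨_, hf.insert hvD (by simp [hFυ.num, hnext]) fun i hi w => ?_⟩,
      by simpa using hregsυ, ?_⟩
    · rw [State.setNum_vert, hmemυ i hi, hbitsτ']
    · simp only [State.setNum_ops, Finset.card_insert_of_notMem hvD]
      nlinarith
  · rintro τ hF ⟨⟨f, hf⟩, hregsτ, hops⟩
    have hLτ : τ.num nBits = L := by simp [hF.num, hL]
    rw [hall] at hops hf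
    subst hLτ
    obtain ⟨idx, hidx⟩ := hf.exists_storesBits hle
    exact ⟨⟨idx, by simpa using hidx.le_two_pow, by simpa using hidx.mem_iff⟩, hregsτ, by
      rw [Finset.card_univ] at hops
      simp only [State.tick_ops, State.setNum_ops]
      omega⟩

theorem writesTo_numberWorklist : numberWorklist.WritesTo {nCard, nNumber, nBit, nIndex}
    (insert vWorklist (insert vPicked (Set.Ici vBits))) := by
  have hbody := writesTo_storeBits.mono (N' := {nCard, nNumber, nBit, nIndex})
    (W' := insert vWorklist (insert vPicked (Set.Ici vBits))) (by simp [Set.insert_subset_iff])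
    ((Set.subset_insert _ _).trans (Set.subset_insert _ _))
  simp [numberWorklist, block, Stmt.WritesTo, hbody]

def numberVertices : Stmt := block [
  computeSizes,
  .sym (.vertOp .union vWorklist vAll vAll),
  .assign nIndex 0,
  numberWorklist]

theorem writesTo_numberVertices : numberVertices.WritesTo
    {nVertices, nBits, nPower, nThreshold, nCard, nNumber, nBit, nIndex}
    (insert vWorklist (insert vPicked (Set.Ici vBits))) := by
  have hsizes := writesTo_computeSizes.mono
    (N' := {nVertices, nBits, nPower, nThreshold, nCard, nNumber, nBit, nIndex})
    (W' := insert vWorklist (insert vPicked (Set.Ici vBits))) (by simp [Set.insert_subset_iff])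
    (Set.empty_subset _)
  have hnumber := writesTo_numberWorklist.mono
    (N' := {nVertices, nBits, nPower, nThreshold, nCard, nNumber, nBit, nIndex})
    (by simp [Set.insert_subset_iff]) subset_rfl
  simp [numberVertices, block, Stmt.WritesTo, Instr.WritesTo, hsizes, hnumber]

theorem runs_numberVertices (hch : ∀ t X, X.Nonempty → choice t X ∈ X) [Nonempty V] (P : MDP V)
    (k : ℕ) : Runs choice numberVertices (init P k) fun τ =>
      ∃ (L h : ℕ) (idx : V ≃ Fin (Fintype.card V)), Env P idx L h τ ∧
        2 ^ L ≤ 2 * Fintype.card V ∧ Fintype.card V ≤ h * h ∧ h * h ≤ 4 * Fintype.card V ∧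
        τ.ops ≤ (L + 3) * Fintype.card V + 3 := by
  simp only [numberVertices, runs_block_cons, runs_block_nil, runs_sym, runs_assign]
  refine (runs_computeSizes rfl).mono_frame writesTo_computeSizes ?_
  rintro σ₁ hF₁ ⟨hn₁, ⟨hle, hbits⟩, ⟨hthreshold, hthreshold'⟩, hops₁⟩
  have hregs₁ : σ₁.vertRegs ≤ 3 := hF₁.vertRegs_le 3 (by simp) le_rfl
  have hall₁ : σ₁.vert vAll = Finset.univ := by simp [hF₁.vert, init]
  have hempty₁ (i : ℕ) : Function.update σ₁.vert vWorklist Finset.univ (vBits + i) = ∅ := by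
    rw [Function.update_of_ne (by omega), hF₁.vert _ (by simp)]
    simp [init, show vBits + i ≠ 1 by omega, show vBits + i ≠ 2 by omega]
  refine (runs_numberWorklist hch (L := σ₁.num nBits) (by simp [hall₁]) (by simp) (by simp) hle
    (by simpa [hall₁] using hempty₁) (by simp; omega)).mono_frame writesTo_numberWorklist ?_
  rintro σ₂ hF₂ ⟨⟨idx, hidx⟩, hregs₂, hops₂⟩
  refine ⟨σ₁.num nBits, σ₁.num nThreshold, idx, ?_, hbits, hthreshold, hthreshold', ?_⟩
  · exact {
      edges := by simp [hF₂.edge, hF₁.edge, init]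
      all := by simp [hF₂.vert, hall₁]
      random := by simp [hF₂.vert, hF₁.vert, init]
      vertices := by simp [hF₂.num, hn₁]
      numBits := by simp [hF₂.num]
      threshold := by simp [hF₂.num]
      bits := hidx
      vertRegs_le := hregs₂
      edgeRegs := by simp [hF₂.edgeRegs, hF₁.edgeRegs, init] }
  · simp only [State.setNum_ops, State.tick_ops, State.setVert_ops, Instr.effect, hops₁,
      init] at hops₂
    omega

/-- The initial number in `nRefreshed` is large enough for `Stage.degree` to hold trivially. -/
def setup : Stmt := block [
  numberVertices,
  .sym (.vertOp .union vUndecided vAll vAll),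
  .assign nRefreshed (2 * reg nThreshold + reg nVertices + 1),
  .sym (.card nUndecided vUndecided)]

theorem runs_setup (hch : ∀ t X, X.Nonempty → choice t X ∈ X) [Nonempty V] (P : MDP V) (k : ℕ) :
    Runs choice setup (init P k) fun τ => ∃ (L h : ℕ) (idx : V ≃ Fin (Fintype.card V)),
      Stage P idx L h Finset.univ ∅ ∅ τ ∧ 2 ^ L ≤ 2 * Fintype.card V ∧
      Fintype.card V ≤ h * h ∧ h * h ≤ 4 * Fintype.card V ∧
      τ.num nRefreshed = 2 * h + Fintype.card V + 1 ∧
      τ.ops ≤ (L + 3) * Fintype.card V + 5 := by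
  simp only [setup, runs_block_cons, runs_block_nil, runs_sym, runs_assign]
  refine (runs_numberVertices hch P k).mono_frame writesTo_numberVertices ?_
  rintro σ hF ⟨L, h, idx, hE, hL, hh, hh', hops⟩
  have hzero (a : Fin 4) (i : ℕ) : σ.num (cellAddr a i) = 0 := by simp [hF.num, init]
  have hrest : σ.vert vRest = ∅ := by simp [hF.vert, init]
  have hout : σ.out = [] := hF.out
  have hF' (x y : ℕ) (X : Finset V) : Frame {nRefreshed, nUndecided} {vUndecided} σ
      (((σ.setVert vUndecided X).tick.setNum nRefreshed x).setNum nUndecided y).tick :=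
    (Frame.refl _ _ σ).setVert.tick.setNum.setNum.tick
  refine ⟨L, h, idx, ?_, hL, hh, hh', ?_, ?_⟩
  · exact {
      env := hE.of_frame (hF' _ _ _) (by simp) (by simp)
      undecided := by simp [hE.all]
      card := by simp [hE.all]
      decided := fun v => by simp [hzero]
      decomposition := by simpa [hrest, hout] using MDP.PartialDecomposition.univ P
      graph := ⟨fun v => by simp [hzero], fun e => by simp [hzero], .empty P _⟩
      degree := fun v _ => by
        simp [hE.threshold, hE.vertices]
        omega }
  · simp [hE.threshold, hE.vertices]
  · simpa using hops

end Setup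

/-! ## The program -/

section Program

def mecDecomposition : Stmt := block [setup, .loop (reg nUndecided) iteration, .sym (.emit vRest)]

theorem ops_le_of_potential_le {n L h s t : ℕ} (hn : 0 < n) (hL : 0 < L) (hh : 0 < h)
    (hnh : n ≤ h * h) (hs : s ≤ (L + 3) * n + 5)
    (ht : h * t ≤ h * s + (L + 9) * n * (2 * h + n + 1) + (8 * n + h * (2 * L + 27)) * n +
      h * ((L + 3) * (2 * h) * n)) : t ≤ 94 * (n * h * L) := by
  refine Nat.le_of_mul_le_mul_left ?_ hh
  have hhh : h ≤ h * h := Nat.le_mul_self h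
  calc h * t
    _ ≤ h * ((L + 3) * n + 5) + (L + 9) * n * (2 * h + n + 1) +
          (8 * n + h * (2 * L + 27)) * n + h * ((L + 3) * (2 * h) * n) := by grw [ht, hs]
    _ ≤ (h * h) * ((L + 3 * L) * n + 5 * (n * L)) + (L + 9 * L) * n * (4 * (h * h)) +
          (8 * (h * h * L) + (h * h) * (2 * L + 27 * L)) * n + h * ((L + 3 * L) * (2 * h) * n) := by
        have hnL : 0 < n * L := Nat.mul_pos hn hL
        gcongr <;> first | omega | nlinarith
    _ = h * (94 * (n * h * L)) := by ring

theorem runs_mecDecomposition (hch : ∀ t X, X.Nonempty → choice t X ∈ X) [Nonempty V]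
    (P : MDP V) (k : ℕ) :
    Runs choice mecDecomposition (init P k) fun τ => P.IsMECDecomposition τ.out ∧
      ∃ L h, 2 ^ L ≤ 2 * Fintype.card V ∧ h * h ≤ 4 * Fintype.card V ∧
        τ.ops ≤ 95 * (Fintype.card V * h * L) ∧ τ.space ≤ 12 + L := by
  simp only [mecDecomposition, runs_block_cons, runs_block_nil, runs_sym]
  refine (runs_setup hch P k).mono ?_
  rintro σ ⟨L, h, idx, hS, hL, hh, hh', hrefreshed, hops⟩
  refine runs_loop (fun τ => ∃ A K F, Stage P idx L h A K F τ ∧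
    potential (Fintype.card V) L h A K τ ≤ potential (Fintype.card V) L h Finset.univ ∅ σ)
    (fun τ => (τ.vert vUndecided).card) ⟨_, _, _, hS, le_rfl⟩ ?_ ?_
  · rintro τ ⟨A, K, F, hSτ, hpot⟩ hc
    have hA : A.Nonempty := by simpa [hSτ.card, Finset.nonempty_iff_ne_empty] using hc
    refine (runs_iteration hch hA hSτ).mono ?_
    rintro υ ⟨A', hA', K', F', hSυ, hpot'⟩
    exact ⟨⟨A', K', F', hSυ, hpot'.trans hpot⟩, by
      simpa [hSτ.undecided, hSυ.undecided] using Finset.card_lt_card hA'⟩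
  · rintro τ ⟨A, K, F, hSτ, hpot⟩ hc
    obtain rfl : A = ∅ := by simpa [hSτ.card] using hc
    have hout := hSτ.decomposition.isMECDecomposition
    refine ⟨by simpa [Instr.effect] using hout, L, h, hL, hh', ?_, ?_⟩
    · have hbound : h * τ.ops ≤ potential (Fintype.card V) L h ∅ K τ := by
        simp only [potential, add_assoc, Nat.le_add_right]
      have hbound' := hbound.trans hpot
      simp only [potential, hrefreshed, Finset.sdiff_empty, Finset.card_univ] at hbound'
      have hn : 0 < Fintype.card V := Fintype.card_pos
      have hLpos : 0 < L := Nat.pos_of_ne_zero (by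
        rintro rfl
        have hle := hSτ.env.bits.le_two_pow
        rw [hSτ.env.numBits] at hle
        have := P.one_lt_card
        omega)
      have hhpos : 0 < h := Nat.pos_of_ne_zero (by rintro rfl; omega)
      have hτops := ops_le_of_potential_le hn hLpos hhpos hh hops hbound'
      have hpos : 0 < Fintype.card V * h * L := by positivity
      simp [Instr.effect]
      omega
    · have hregs := hSτ.env.vertRegs_le
      simp [State.space, Instr.effect, hSτ.env.edgeRegs]
      omega

def mecProgram : Program := ⟨mecDecomposition, []⟩

theorem half_le_log {n : ℕ} (hn : 1 < n) : 1 / 2 ≤ Real.log n := by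
  have hlog := Real.log_le_log two_pos (by exact_mod_cast hn : (2 : ℝ) ≤ n)
  linarith [Real.log_two_gt_d9]

theorem natCast_le_log_of_two_pow_le {n L : ℕ} (hn : 1 < n) (hL : 2 ^ L ≤ 2 * n) :
    (L : ℝ) ≤ 4 * Real.log n := by
  have hpow : (2 : ℝ) ^ L ≤ (n : ℝ) ^ 2 := by exact_mod_cast hL.trans (by nlinarith)
  have hlog := Real.log_le_log (by positivity) hpow
  rw [Real.log_pow, Real.log_pow] at hlog
  push_cast at hlog
  nlinarith [half_le_log one_lt_two, Nat.cast_nonneg (α := ℝ) L]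

theorem natCast_le_sqrt_of_mul_self_le {n h : ℕ} (hh : h * h ≤ 4 * n) :
    (h : ℝ) ≤ 2 * √n := by
  refine le_of_sq_le_sq ?_ (by positivity)
  rw [mul_pow, Real.sq_sqrt n.cast_nonneg, sq]
  exact_mod_cast hh

theorem computesMECs_mecProgram [Nonempty V] (P : MDP V) (k : ℕ) :
    mecProgram.ComputesMECs P k
      (760 * ((Fintype.card V : ℝ) ^ (3 / 2 : ℝ) * Real.log (Fintype.card V)))
      (28 * Real.log (Fintype.card V)) := by
  intro choice hch
  obtain ⟨τ, hτ, hout, L, h, hL, hh, hops, hspace⟩ := runs_mecDecomposition hch P k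
  have hn := P.one_lt_card
  have hlogL := natCast_le_log_of_two_pow_le hn hL
  refine ⟨τ, hτ, hout, ?_, ?_⟩
  · have hcard : (0 : ℝ) < Fintype.card V := by positivity
    calc (τ.ops : ℝ)
      _ ≤ 95 * (Fintype.card V * h * L) := by exact_mod_cast hops
      _ ≤ 95 * (Fintype.card V * (2 * √(Fintype.card V)) * (4 * Real.log (Fintype.card V))) := by
          gcongr
          exact natCast_le_sqrt_of_mul_self_le hh
      _ = 760 * ((Fintype.card V : ℝ) ^ (1 + 1 / 2 : ℝ) * Real.log (Fintype.card V)) := by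
          rw [Real.rpow_one_add' hcard.le (by norm_num), ← Real.sqrt_eq_rpow]
          ring
      _ = _ := by norm_num
  · have hspace' : (τ.space : ℝ) ≤ 12 + L := by exact_mod_cast hspace
    linarith [half_le_log hn]

theorem Program.ComputesMECs.mono {prog : Program} {P : MDP V} {k : ℕ} {S S' T T' : ℝ}
    (h : prog.ComputesMECs P k T S) (hT : T ≤ T') (hS : S ≤ S') : prog.ComputesMECs P k T' S' :=
  fun choice hch =>
    let ⟨τ, hτ, hout, hops, hspace⟩ := h choice hch
    ⟨τ, hτ, hout, hops.trans hT, hspace.trans hS⟩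

theorem Program.ComputesMECs.of_le_half [Nonempty V] {prog : Program} {P : MDP V} {k : ℕ}
    {C ε : ℝ} (hC : 0 ≤ C) (hε : 0 ≤ ε) (hε' : ε ≤ 1 / 2)
    (h : prog.ComputesMECs P k
      (C * ((Fintype.card V : ℝ) ^ (3 / 2 : ℝ) * Real.log (Fintype.card V)))
      (C * Real.log (Fintype.card V))) :
    prog.ComputesMECs P k
      (C * ((Fintype.card V : ℝ) ^ (2 - ε) * Real.log (Fintype.card V)))
      (C * ((Fintype.card V : ℝ) ^ ε * Real.log (Fintype.card V))) := by
  have hn : (1 : ℝ) ≤ Fintype.card V := by exact_mod_cast Fintype.card_pos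
  have hlog := Real.log_nonneg hn
  refine h.mono ?_ ?_
  · gcongr
    linarith
  · gcongr
    exact le_mul_of_one_le_left hlog (Real.one_le_rpow hn hε)

end Program

end Symbolic

theorem mainTheorem1_general :
    ∃ prog : Symbolic.Program, ∃ C : ℝ, 0 ≤ C ∧
      ∀ (V : Type*) [Fintype V] [DecidableEq V] [Nonempty V] (P : MDP V) (k : ℕ),
        prog.ComputesMECs P k
          (C * ((Fintype.card V : ℝ) ^ (3 / 2 : ℝ) * Real.log (Fintype.card V)))
          (C * Real.log (Fintype.card V)) := by
  refine ⟨Symbolic.mecProgram, 760, by norm_num, fun V _ _ _ P k => ?_⟩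
  refine (Symbolic.computesMECs_mecProgram P k).mono le_rfl ?_
  gcongr
  norm_num

theorem mainTheorem1 :
    (∃ prog : Symbolic.Program, ∀ ε : ℝ, 0 < ε → ε ≤ 1 / 2 → ∃ C : ℝ,
      ∀ (V : Type*) [Fintype V] [DecidableEq V] [Nonempty V] (P : MDP V),
        prog.ComputesMECs P ⌈(Fintype.card V : ℝ) ^ ε⌉₊
          (C * ((Fintype.card V : ℝ) ^ (2 - ε) * Real.log (Fintype.card V)))
          (C * ((Fintype.card V : ℝ) ^ ε * Real.log (Fintype.card V)))) ∧
    (∀ ε : ℚ, 0 < ε → ε ≤ 1 / 2 → ∃ prog : Symbolic.Program, ∃ C : ℝ,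
      ∀ (V : Type*) [Fintype V] [DecidableEq V] [Nonempty V] (P : MDP V),
        prog.ComputesMECs P 0
          (C * ((Fintype.card V : ℝ) ^ (2 - (ε : ℝ)) * Real.log (Fintype.card V)))
          (C * ((Fintype.card V : ℝ) ^ (ε : ℝ) * Real.log (Fintype.card V)))) ∧
    (∃ prog : Symbolic.Program, ∃ C : ℝ,
      ∀ (V : Type*) [Fintype V] [DecidableEq V] [Nonempty V] (P : MDP V),
        prog.ComputesMECs P 0
          (C * ((Fintype.card V : ℝ) ^ (3 / 2 : ℝ) * Real.log (Fintype.card V)))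
          (C * (Real.sqrt (Fintype.card V) * Real.log (Fintype.card V)))) := by
  refine ⟨?_, fun ε hε hε' => ?_, ?_⟩
  · obtain ⟨prog, C, hC, h⟩ := mainTheorem1_general
    exact ⟨prog, fun ε hε hε' => ⟨C, fun V _ _ _ P => (h V P _).of_le_half hC hε.le hε'⟩⟩
  · obtain ⟨prog, C, hC, h⟩ := mainTheorem1_general
    have hε_half : (ε : ℝ) ≤ 1 / 2 := by simpa using Rat.cast_le (K := ℝ) |>.2 hε'
    exact ⟨prog, C, fun V _ _ _ P => (h V P 0).of_le_half hC (by exact_mod_cast hε.le) hε_half⟩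
  · obtain ⟨prog, C, hC, h⟩ := mainTheorem1_general
    refine ⟨prog, C, fun V _ _ _ P => ?_⟩
    have h_half := (h V P 0).of_le_half hC (by norm_num) le_rfl
    rwa [show (2 - 1 / 2 : ℝ) = 3 / 2 by norm_num, ← Real.sqrt_eq_rpow] at h_half
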